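/- Let $n\ge 0$, let $M$ be a smooth real manifold of dimension $n+1$ (Hausdorff, second countable) and $\pi:M\to\mathbb R$ a smooth surjective submersion. Let $J^1\pi$ be its first jet bundle, the $(2n+1)$-dimensional manifold of $1$-jets $j^1_t\gamma$ of local sections $\gamma$ of $\pi$ (identified with the affine subbundle $\{v\in TM: d\pi(v)=1\}$ of $TM$ through $j^1_t\gamma\mapsto\gamma'(t)$), with projection $\pi_{10}:J^1\pi\to M$ and natural local coordinates $(t,x^i,y^i)$, where $t$ also denotes the global function $\pi\circ\pi_{10}$. All objects are $C^\infty$. A vector field on $J^1\pi$ is vertical if it takes values in $\ker D\pi_{10}$; a $1$-form $\theta$ on $J^1\pi$ is semi-basic if $\theta(X)=0$ for every vertical vector field $X$. The vertical endomorphism is the $(1,1)$-tensor field $J=\frac{\partial}{\partial y^i}\otimes(dx^i-y^i\,dt)$. A semispray is a vector field $S$ on $J^1\pi$ with $J(S)=0$ and $dt(S)=1$. For vector fields $X,Y$, a $(1,1)$-tensor field $A$ and a $1$-form $\theta$ put $(\mathcal L_X A)(Y)=[X,AY]-A[X,Y]$ and $d_A\theta=i_A d\theta-d(\theta\circ A)$,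 where $(i_A\omega)(X,Y)=\omega(AX,Y)+\omega(X,AY)$ for a $2$-form $\omega$; $\theta$ is $d_A$-closed if $d_A\theta=0$. The horizontal projector induced by a semispray $S$ is $h=\tfrac12(\mathrm{Id}-\mathcal L_SJ+S\otimes dt)$. Theorem. Let $S$ be a semispray on $J^1\pi$ and let $\theta$ be a semi-basic, $d_J$-closed $1$-form on $J^1\pi$. Then the following conditions are equivalent: 1. $\mathcal L_S\theta$ is closed, i.e. $d(\mathcal L_S\theta)=0$; 2. $\mathcal L_S\theta$ is exact, i.e. $\mathcal L_S\theta=df$ for some $f\in C^\infty(J^1\pi)$; 3. $\mathcal L_S\theta=d(i_S\theta)$; 4. $d_h\theta=0$. -/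

import Mathlib

open scoped Manifold ContDiff

set_option linter.unusedSectionVars false

noncomputable section

namespace JetMech

/-! ### Functions, vector fields and forms on a manifold -/

section Calculus

variable (E : Type*) [NormedAddCommGroup E] [NormedSpace ℝ E]
variable (N : Type*) [TopologicalSpace N] [ChartedSpace E N] [IsManifold 𝓘(ℝ, E) ∞ N]

/-- The ring of smooth real functions on a manifold `N` modelled on `E`. -/
abbrev SmoothFn := C^∞⟮𝓘(ℝ, E), N; 𝓘(ℝ, ℝ), ℝ⟯

/-- The smooth vector fields on `N`. -/
abbrev VecField := Cₛ^∞⟮𝓘(ℝ, E); E, (TangentSpace 𝓘(ℝ, E) : N → Type _)⟯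

variable {E N}

/-- Vector fields form a module over the smooth functions, with pointwise multiplication. -/
instance : SMul (SmoothFn E N) (VecField E N) :=
  ⟨fun f X => ⟨(f : N → ℝ) • (X : ∀ x, TangentSpace 𝓘(ℝ, E) x),
    f.contMDiff.smul_section X.contMDiff⟩⟩

theorem smul_apply (f : SmoothFn E N) (X : VecField E N) (x : N) : (f • X) x = f x • X x := rfl

instance : Module (SmoothFn E N) (VecField E N) where
  one_smul X := by ext x; exact one_smul ℝ (X x)
  mul_smul f g X := by ext x; exact mul_smul (f x) (g x) (X x)
  smul_zero f := by ext x; exact smul_zero (f x)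
  smul_add f X Y := by ext x; exact smul_add (f x) (X x) (Y x)
  add_smul f g X := by ext x; exact add_smul (f x) (g x) (X x)
  zero_smul X := by ext x; exact zero_smul ℝ (X x)

/-- The Lie bracket `[X, Y]` of smooth vector fields. -/
def bracket [CompleteSpace E] (X Y : VecField E N) : VecField E N :=
  ⟨VectorField.mlieBracket 𝓘(ℝ, E) X Y, fun x => by
    have : IsManifold 𝓘(ℝ, E) (minSmoothness ℝ 2) N := by
      rw [minSmoothness_of_isRCLikeNormedField]; infer_instance
    have : IsManifold 𝓘(ℝ, E) (((⊤ : ℕ∞) : WithTop ℕ∞) + 1) N := by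
      change IsManifold 𝓘(ℝ, E) ∞ N; infer_instance
    exact ContMDiffAt.mlieBracket_vectorField (m := ⊤) (n := ⊤) (X.contMDiff x) (Y.contMDiff x)
      (by simp)⟩

/-- The derivative `X f = df(X)` of a smooth function along a vector field. -/
def derivAlong (X : VecField E N) (f : SmoothFn E N) : SmoothFn E N :=
  ⟨fun x => mvfderiv 𝓘(ℝ, E) f x (X x), by
    have h1 : ContMDiff 𝓘(ℝ, E) 𝓘(ℝ, ℝ).tangent ∞ (fun x => tangentMap 𝓘(ℝ, E) 𝓘(ℝ, ℝ) f
        (Bundle.TotalSpace.mk' E x (X x))) :=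
      (f.contMDiff.contMDiff_tangentMap (m := ∞) (by simp)).comp X.contMDiff
    exact (contMDiff_snd_tangentBundle_modelSpace ℝ 𝓘(ℝ, ℝ)).comp h1⟩

theorem bracket_swap [CompleteSpace E] (X Y : VecField E N) : bracket X Y = -bracket Y X := by
  ext x; exact VectorField.mlieBracket_swap_apply

theorem bracket_add_right [CompleteSpace E] (X Y Z : VecField E N) :
    bracket X (Y + Z) = bracket X Y + bracket X Z := by
  have : IsManifold 𝓘(ℝ, E) 2 N := inferInstance
  ext x; exact VectorField.mlieBracket_add_right Y.mdifferentiableAt Z.mdifferentiableAt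

theorem bracket_smul_right [CompleteSpace E] (X : VecField E N) (f : SmoothFn E N)
    (Y : VecField E N) : bracket X (f • Y) = derivAlong X f • Y + f • bracket X Y := by
  have : IsManifold 𝓘(ℝ, E) 2 N := inferInstance
  ext x; exact VectorField.mlieBracket_smul_right f.mdifferentiableAt Y.mdifferentiableAt

theorem bracket_add_left [CompleteSpace E] (X Y Z : VecField E N) :
    bracket (X + Y) Z = bracket X Z + bracket Y Z := by
  rw [bracket_swap, bracket_add_right, neg_add, ← bracket_swap, ← bracket_swap]

theorem bracket_smul_left [CompleteSpace E] (f : SmoothFn E N) (X Y : VecField E N) :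
    bracket (f • X) Y = f • bracket X Y - derivAlong Y f • X := by
  rw [bracket_swap, bracket_smul_right, bracket_swap Y X, smul_neg]; abel

theorem derivAlong_add (X : VecField E N) (f g : SmoothFn E N) :
    derivAlong X (f + g) = derivAlong X f + derivAlong X g := by
  ext x
  exact congrArg (· (X x)) (mvfderiv_add f.mdifferentiableAt g.mdifferentiableAt)

theorem derivAlong_mul (X : VecField E N) (f g : SmoothFn E N) :
    derivAlong X (f * g) = f * derivAlong X g + derivAlong X f * g := by
  ext x
  have := congrArg (· (X x)) (mvfderiv_mul (I := 𝓘(ℝ, E)) (x := x) f.mdifferentiableAt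
    g.mdifferentiableAt)
  simp at this
  change mvfderiv 𝓘(ℝ, E) (⇑f * ⇑g) x (X x) = f x * mvfderiv 𝓘(ℝ, E) g x (X x)
    + mvfderiv 𝓘(ℝ, E) f x (X x) * g x
  rw [this]; ring

theorem derivAlong_add_left (X Y : VecField E N) (f : SmoothFn E N) :
    derivAlong (X + Y) f = derivAlong X f + derivAlong Y f := by
  ext x; exact map_add (mvfderiv 𝓘(ℝ, E) f x) (X x) (Y x)

theorem derivAlong_smul_left (g : SmoothFn E N) (X : VecField E N) (f : SmoothFn E N) :
    derivAlong (g • X) f = g * derivAlong X f := by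
  ext x; exact map_smul (mvfderiv 𝓘(ℝ, E) f x) (g x) (X x)

variable (E N)

/-- Differential `1`-forms, as `C^∞(N)`-linear maps from vector fields to functions (on a Hausdorff
second countable finite-dimensional `N` these are the smooth sections of the cotangent bundle). -/
abbrev OneForm := VecField E N →ₗ[SmoothFn E N] SmoothFn E N

/-- The `C^∞(N)`-bilinear maps from pairs of vector fields to functions, i.e. covariant `2`-tensor
fields. All those which occur below are `2`-forms (they are skew-symmetric). -/
abbrev BilinForm := VecField E N →ₗ[SmoothFn E N] VecField E N →ₗ[SmoothFn E N] SmoothFn E N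

/-- Tensor fields of type `(1,1)` (vector valued `1`-forms), as `C^∞(N)`-linear endomorphisms of
the module of vector fields. -/
abbrev EndoField := VecField E N →ₗ[SmoothFn E N] VecField E N

variable {E N}

/-- The differential `df` of a function, `df(X) = X f`. -/
def extDFun (f : SmoothFn E N) : OneForm E N where
  toFun X := derivAlong X f
  map_add' X Y := derivAlong_add_left X Y f
  map_smul' g X := derivAlong_smul_left g X f

variable [CompleteSpace E]

/-- The exterior derivative of a `1`-form,
`dα(X, Y) = X(α(Y)) - Y(α(X)) - α([X, Y])`. -/
def extDOne (α : OneForm E N) : BilinForm E N :=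
  LinearMap.mk₂ (SmoothFn E N)
    (fun X Y => derivAlong X (α Y) - derivAlong Y (α X) - α (bracket X Y))
    (fun X Y Z => by
      simp only [map_add, derivAlong_add, derivAlong_add_left, bracket_add_left]; abel)
    (fun f X Y => by
      simp only [map_smul, smul_eq_mul, derivAlong_mul, derivAlong_smul_left, bracket_smul_left,
        map_sub]
      ring)
    (fun X Y Z => by
      simp only [map_add, derivAlong_add, derivAlong_add_left, bracket_add_right]; abel)
    (fun f X Y => by
      simp only [map_smul, smul_eq_mul, derivAlong_mul, derivAlong_smul_left, bracket_smul_right,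
        map_add]
      ring)

/-- The Lie derivative of a `1`-form, `(L_X α)(Y) = X(α(Y)) - α([X, Y])`. -/
def lieDOne (X : VecField E N) (α : OneForm E N) : OneForm E N where
  toFun Y := derivAlong X (α Y) - α (bracket X Y)
  map_add' Y Z := by simp only [map_add, derivAlong_add, bracket_add_right]; abel
  map_smul' f Y := by
    simp only [map_smul, smul_eq_mul, derivAlong_mul, bracket_smul_right, map_add, RingHom.id_apply]
    ring

/-- The Lie derivative of a tensor field of type `(1,1)`,
`(L_X A)(Y) = [X, A Y] - A [X, Y]`. -/
def lieDEndo (X : VecField E N) (A : EndoField E N) : EndoField E N where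
  toFun Y := bracket X (A Y) - A (bracket X Y)
  map_add' Y Z := by simp only [map_add, bracket_add_right]; abel
  map_smul' f Y := by
    simp only [map_smul, bracket_smul_right, map_add, RingHom.id_apply, smul_sub]; abel

/-- The exterior inner product `i_A α = α ∘ A` of a `1`-form with a tensor field of type `(1,1)`. -/
def innerOne (A : EndoField E N) (α : OneForm E N) : OneForm E N := α ∘ₗ A

/-- The exterior inner product of a `2`-form with a tensor field of type `(1,1)`,
`(i_A β)(X, Y) = β(A X, Y) + β(X, A Y)`. -/
def innerTwo (A : EndoField E N) (β : BilinForm E N) : BilinForm E N :=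
  β ∘ₗ A + β.compl₂ A

/-- The exterior derivative of a `1`-form with respect to a tensor field of type `(1,1)`,
`d_A = i_A ∘ d - d ∘ i_A`. -/
def extDWrt (A : EndoField E N) (α : OneForm E N) : BilinForm E N :=
  innerTwo A (extDOne α) - extDOne (innerOne A α)

/-- The tensor field `X ⊗ α` of type `(1,1)`, `(X ⊗ α)(Y) = α(Y) X`. -/
def tensorEndo (X : VecField E N) (α : OneForm E N) : EndoField E N := α.smulRight X

end Calculus

/-! ### The first jet bundle of a manifold fibred over the real line -/

section Jets

/-- The model space of an `(n+1)`-dimensional manifold. -/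
abbrev E1 (n : ℕ) := EuclideanSpace ℝ (Fin (n + 1))

/-- The model space of the `(2n+1)`-dimensional first jet bundle. -/
abbrev JModel (n : ℕ) := EuclideanSpace ℝ (Fin (n + 1)) × EuclideanSpace ℝ (Fin n)

variable {n : ℕ} {M : Type*} [TopologicalSpace M] [ChartedSpace (E1 n) M]
  [IsManifold (𝓡 (n + 1)) ∞ M]

variable (n M) in
/-- A fibration `π : M → ℝ` of an `(n+1)`-dimensional manifold over the real line: a smooth
surjective submersion. -/
structure TimeFibration where
  toFun : M → ℝ
  contMDiff : ContMDiff (𝓡 (n + 1)) 𝓘(ℝ, ℝ) ∞ toFun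
  surjective : Function.Surjective toFun
  submersion : ∀ m, Function.Surjective (mvfderiv (𝓡 (n + 1)) toFun m)

/-- The linear form `dt = dπ` on the tangent space of `M` at `m`. -/
def TimeFibration.dt (π : TimeFibration n M) (m : M) : TangentSpace (𝓡 (n + 1)) m →L[ℝ] ℝ :=
  mvfderiv (𝓡 (n + 1)) π.toFun m

/-- The first jet bundle `J¹π`. The `1`-jet at `t` of a local section `γ` of `π : M → ℝ` is the
datum of `γ(t)` and `γ'(t)`, and the tangent vectors arising in this way are those with
`dt(γ'(t)) = 1`: this is the standard identification of `J¹π` with an affine subbundle of `TM`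
(see `jet` and `exists_jet_eq` below for the correspondence with jets of sections). -/
structure JetBundle (π : TimeFibration n M) where
  toTM : TangentBundle (𝓡 (n + 1)) M
  dt_toTM : π.dt toTM.1 toTM.2 = 1

instance (π : TimeFibration n M) : TopologicalSpace (JetBundle π) :=
  TopologicalSpace.induced JetBundle.toTM inferInstance

theorem continuous_toTM (π : TimeFibration n M) :
    Continuous (JetBundle.toTM : JetBundle π → TangentBundle (𝓡 (n + 1)) M) :=
  continuous_induced_dom

theorem JetBundle.ext_toTM {π : TimeFibration n M} {u v : JetBundle π} (h : u.toTM = v.toTM) :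
    u = v := by
  cases u; cases v; cases h; rfl

/-! Charts of the jet bundle. -/

/-- Forget the `i`-th coordinate. -/
def dropL (i : Fin (n + 1)) : E1 n →L[ℝ] EuclideanSpace ℝ (Fin n) :=
  LinearMap.toContinuousLinearMap
    { toFun := fun y => WithLp.toLp 2 fun j => y (i.succAbove j)
      map_add' := fun _ _ => rfl
      map_smul' := fun _ _ => rfl }

/-- Insert `0` as the `i`-th coordinate. -/
def insL (i : Fin (n + 1)) : EuclideanSpace ℝ (Fin n) →L[ℝ] E1 n :=
  LinearMap.toContinuousLinearMap
    { toFun := fun z => WithLp.toLp 2 (i.insertNth (0 : ℝ) (fun j => z j))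
      map_add' := fun y z => by
        ext k; induction k using i.succAboveCases <;> simp
      map_smul' := fun c z => by
        ext k; induction k using i.succAboveCases <;> simp }

/-- The `i`-th basis vector. -/
def basisVec (i : Fin (n + 1)) : E1 n := EuclideanSpace.single i (1 : ℝ)

theorem dropL_apply (i : Fin (n + 1)) (y : E1 n) (j : Fin n) :
    dropL i y j = y (i.succAbove j) := rfl

theorem insL_apply (i : Fin (n + 1)) (z : EuclideanSpace ℝ (Fin n)) (k : Fin (n + 1)) :
    insL i z k = i.insertNth (α := fun _ => ℝ) (0 : ℝ) (fun j => z j) k := rfl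

theorem drop_ins (i : Fin (n + 1)) (z) : dropL i (insL i z) = z := by
  ext j; simp [dropL_apply, insL_apply]

theorem drop_basisVec (i : Fin (n + 1)) : dropL i (basisVec i) = 0 := by
  ext j; simp [dropL_apply, basisVec]

theorem ins_drop (i : Fin (n + 1)) (y : E1 n) : insL i (dropL i y) + y i • basisVec i = y := by
  ext k; induction k using i.succAboveCases <;> simp [dropL_apply, insL_apply, basisVec]

/-- The affine inverse of `dropL i` on the hyperplane `{y | a y = 1}`, for a linear form `a` whose
`i`-th coefficient does not vanish. -/
def fill (i : Fin (n + 1)) (a : E1 n →L[ℝ] ℝ) (z : EuclideanSpace ℝ (Fin n)) : E1 n :=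
  insL i z + ((1 - a (insL i z)) / a (basisVec i)) • basisVec i

theorem drop_fill (i : Fin (n + 1)) (a : E1 n →L[ℝ] ℝ) (z) : dropL i (fill i a z) = z := by
  simp [fill, drop_ins, drop_basisVec]

theorem apply_fill (i : Fin (n + 1)) (a : E1 n →L[ℝ] ℝ) (ha : a (basisVec i) ≠ 0) (z) :
    a (fill i a z) = 1 := by
  simp [fill, ha]

theorem fill_drop (i : Fin (n + 1)) (a : E1 n →L[ℝ] ℝ) (ha : a (basisVec i) ≠ 0) (y : E1 n)
    (hy : a y = 1) : fill i a (dropL i y) = y := by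
  have h := congrArg a (ins_drop i y)
  rw [map_add, map_smul, hy, smul_eq_mul] at h
  have : (1 - a (insL i (dropL i y))) / a (basisVec i) = y i := by
    rw [div_eq_iff ha]; linarith
  rw [fill, this, ins_drop]

/-- The chart of `TM` induced by the preferred chart of `M` at `m`. -/
def tmChart (m : M) : OpenPartialHomeomorph (TangentBundle (𝓡 (n + 1)) M) (ModelProd (E1 n) (E1 n)) :=
  chartAt (ModelProd (E1 n) (E1 n)) (⟨m, 0⟩ : TangentBundle (𝓡 (n + 1)) M)

/-- The differential at `x` of the coordinate expression of `π` in the preferred chart at `m`. -/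
def TimeFibration.loc (π : TimeFibration n M) (m : M) (x : E1 n) : E1 n →L[ℝ] ℝ :=
  fderiv ℝ (π.toFun ∘ (chartAt (E1 n) m).symm) x

theorem TimeFibration.contDiffOn_comp_symm (π : TimeFibration n M) (m : M) :
    ContDiffOn ℝ ∞ (π.toFun ∘ (chartAt (E1 n) m).symm) (chartAt (E1 n) m).target := by
  rw [← contMDiffOn_iff_contDiffOn]
  exact π.contMDiff.comp_contMDiffOn (contMDiffOn_chart_symm (I := 𝓡 (n + 1)))

theorem TimeFibration.contDiffOn_loc (π : TimeFibration n M) (m : M) :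
    ContDiffOn ℝ ∞ (π.loc m) (chartAt (E1 n) m).target :=
  (π.contDiffOn_comp_symm m).fderiv_of_isOpen (chartAt (E1 n) m).open_target (by simp)

theorem TimeFibration.dt_eq_loc (π : TimeFibration n M) (m : M)
    (q : TangentBundle (𝓡 (n + 1)) M) (hq : q.1 ∈ (chartAt (E1 n) m).source) :
    π.dt q.1 q.2 = π.loc m (chartAt (E1 n) m q.1) (tmChart m q).2 := by
  have hmem : chartAt (E1 n) m q.1 ∈ (chartAt (E1 n) m).target := (chartAt (E1 n) m).map_source hq
  have hd : DifferentiableAt ℝ (π.toFun ∘ (chartAt (E1 n) m).symm) (chartAt (E1 n) m q.1) :=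
    ((π.contDiffOn_comp_symm m).contDiffAt
      ((chartAt (E1 n) m).open_target.mem_nhds hmem)).differentiableAt (by simp)
  have hc : MDifferentiableAt (𝓡 (n + 1)) (𝓡 (n + 1)) (chartAt (E1 n) m) q.1 :=
    mdifferentiableAt_atlas (chart_mem_atlas _ _) hq
  have heq : π.toFun =ᶠ[nhds q.1] (π.toFun ∘ (chartAt (E1 n) m).symm) ∘ chartAt (E1 n) m := by
    filter_upwards [(chartAt (E1 n) m).open_source.mem_nhds hq] with y hy
    simp [(chartAt (E1 n) m).left_inv hy]
  have h1 : mfderiv (𝓡 (n + 1)) 𝓘(ℝ, ℝ) π.toFun q.1 =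
      (mfderiv 𝓘(ℝ, E1 n) 𝓘(ℝ, ℝ) (π.toFun ∘ (chartAt (E1 n) m).symm)
        (chartAt (E1 n) m q.1)).comp (mfderiv (𝓡 (n + 1)) (𝓡 (n + 1)) (chartAt (E1 n) m) q.1) := by
    rw [heq.mfderiv_eq]
    exact mfderiv_comp _ hd.mdifferentiableAt hc
  have h2 := tangentMap_chart (I := 𝓡 (n + 1)) (p := (⟨m, 0⟩ : TangentBundle (𝓡 (n + 1)) M))
    (q := q) hq
  have h3 : mfderiv (𝓡 (n + 1)) (𝓡 (n + 1)) (chartAt (E1 n) m) q.1 q.2 = (tmChart m q).2 :=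
    congrArg (fun r : TangentBundle (𝓡 (n + 1)) (E1 n) => (r.2 : E1 n)) h2
  have h4 : π.dt q.1 q.2 = mfderiv (𝓡 (n + 1)) 𝓘(ℝ, ℝ) π.toFun q.1 q.2 := rfl
  rw [h4, h1, mfderiv_eq_fderiv]
  exact congrArg (fun v : E1 n => π.loc m (chartAt (E1 n) m q.1) v) h3

theorem TimeFibration.exists_index (π : TimeFibration n M) (m : M) :
    ∃ i, π.loc m (chartAt (E1 n) m m) (basisVec i) ≠ 0 := by
  by_contra! h
  have h0 : π.loc m (chartAt (E1 n) m m) = 0 := by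
    have : (π.loc m (chartAt (E1 n) m m)).toLinearMap = 0 := by
      refine (EuclideanSpace.basisFun (Fin (n + 1)) ℝ).toBasis.ext fun i => ?_
      simpa [basisVec] using h i
    ext v; exact congrArg (· v) this
  obtain ⟨v, hv⟩ := π.submersion m 1
  have := π.dt_eq_loc m ⟨m, v⟩ (mem_chart_source _ m)
  rw [h0] at this
  change mvfderiv (𝓡 (n + 1)) π.toFun m v = _ at this
  rw [hv] at this
  simp at this

theorem tmChart_fst (m : M) (q : TangentBundle (𝓡 (n + 1)) M) :
    (tmChart m q).1 = chartAt (E1 n) m q.1 := rfl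

theorem mem_tmChart_source (m : M) (q : TangentBundle (𝓡 (n + 1)) M) :
    q ∈ (tmChart m).source ↔ q.1 ∈ (chartAt (E1 n) m).source :=
  TangentBundle.mem_chart_source_iff q ⟨m, 0⟩

theorem mem_tmChart_target (m : M) (p : ModelProd (E1 n) (E1 n)) :
    p ∈ (tmChart m).target ↔ p.1 ∈ (chartAt (E1 n) m).target :=
  TangentBundle.mem_chart_target_iff p ⟨m, 0⟩

theorem tmChart_symm_fst (m : M) (p : ModelProd (E1 n) (E1 n)) :
    ((tmChart m).symm p).1 = (chartAt (E1 n) m).symm p.1 := rfl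

/-- The points of the target of the chart of `M` at `m` where `∂π/∂xⁱ ≠ 0`. -/
def TimeFibration.good (π : TimeFibration n M) (m : M) (i : Fin (n + 1)) : Set (E1 n) :=
  {x | x ∈ (chartAt (E1 n) m).target ∧ π.loc m x (basisVec i) ≠ 0}

theorem TimeFibration.isOpen_good (π : TimeFibration n M) (m : M) (i : Fin (n + 1)) :
    IsOpen (π.good m i) := by
  have hc : ContinuousOn (fun x => π.loc m x (basisVec i)) (chartAt (E1 n) m).target :=
    (π.contDiffOn_loc m).continuousOn.clm_apply continuousOn_const
  exact hc.isOpen_inter_preimage (chartAt (E1 n) m).open_target isOpen_compl_singleton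

theorem TimeFibration.contDiffOn_fill (π : TimeFibration n M) (m : M) (i : Fin (n + 1)) :
    ContDiffOn ℝ ∞ (fun p : JModel n => fill i (π.loc m p.1) p.2) (π.good m i ×ˢ Set.univ) := by
  have h1 : ContDiffOn ℝ ∞ (fun p : JModel n => π.loc m p.1) (π.good m i ×ˢ Set.univ) :=
    (π.contDiffOn_loc m).comp contDiffOn_fst fun p hp => hp.1.1
  have h2 : ContDiffOn ℝ ∞ (fun p : JModel n => insL i p.2) (π.good m i ×ˢ Set.univ) :=
    ((insL i).contDiff.comp contDiff_snd).contDiffOn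
  unfold fill
  refine h2.add (ContDiffOn.smul (ContDiffOn.div (contDiffOn_const.sub (h1.clm_apply h2))
    (h1.clm_apply contDiffOn_const) fun p hp => hp.1.2) contDiffOn_const)

theorem TimeFibration.dt_symm_fill (π : TimeFibration n M) (m : M) (i : Fin (n + 1))
    (p : JModel n) (hp : p.1 ∈ π.good m i) :
    π.dt ((tmChart m).symm (p.1, fill i (π.loc m p.1) p.2)).1
      ((tmChart m).symm (p.1, fill i (π.loc m p.1) p.2)).2 = 1 := by
  have hs : ((tmChart m).symm (p.1, fill i (π.loc m p.1) p.2)).1 ∈ (chartAt (E1 n) m).source :=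
    (chartAt (E1 n) m).map_target hp.1
  have hr : tmChart m ((tmChart m).symm (p.1, fill i (π.loc m p.1) p.2)) =
      (p.1, fill i (π.loc m p.1) p.2) :=
    (tmChart m).right_inv ((mem_tmChart_target m _).2 hp.1)
  rw [π.dt_eq_loc m _ hs, hr, tmChart_symm_fst, (chartAt (E1 n) m).right_inv hp.1]
  exact apply_fill i _ hp.2 _

theorem TimeFibration.fill_eq (π : TimeFibration n M) (m : M) (i : Fin (n + 1))
    (u : JetBundle π) (hs : u.1.1 ∈ (chartAt (E1 n) m).source)
    (hg : chartAt (E1 n) m u.1.1 ∈ π.good m i) :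
    fill i (π.loc m (chartAt (E1 n) m u.1.1)) (dropL i (tmChart m u.1).2) = (tmChart m u.1).2 :=
  fill_drop i _ hg.2 _ (by rw [← π.dt_eq_loc m u.1 hs]; exact u.2)

open Classical in
/-- The inverse of a chart of the jet bundle. -/
def jetChartInv (π : TimeFibration n M) (u₀ : JetBundle π) (i : Fin (n + 1)) (p : JModel n) :
    JetBundle π :=
  if h : π.dt ((tmChart u₀.1.1).symm (p.1, fill i (π.loc u₀.1.1 p.1) p.2)).1
      ((tmChart u₀.1.1).symm (p.1, fill i (π.loc u₀.1.1 p.1) p.2)).2 = 1 then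
    ⟨(tmChart u₀.1.1).symm (p.1, fill i (π.loc u₀.1.1 p.1) p.2), h⟩ else u₀

theorem jetChartInv_coe (π : TimeFibration n M) (u₀ : JetBundle π) (i : Fin (n + 1))
    (p : JModel n) (hp : p.1 ∈ π.good u₀.1.1 i) :
    (jetChartInv π u₀ i p).1 = (tmChart u₀.1.1).symm (p.1, fill i (π.loc u₀.1.1 p.1) p.2) := by
  rw [jetChartInv, dif_pos (π.dt_symm_fill _ _ _ hp)]

/-- The chart `(x, y) ↦ (x, (yʲ)_{j ≠ i})` of the jet bundle, where `x` are the coordinates on `M`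
given by the preferred chart at the base point `m` of `u₀`, and `(x, y)` the induced coordinates on
`TM`; it is defined where `∂π/∂xⁱ ≠ 0`, the coordinate `yⁱ` being determined by `dt = 1`.
When the coordinate `xⁱ` is `π` itself, these are the natural coordinates `(t, x, y)` of `J¹π`. -/
def jetChart (π : TimeFibration n M) (u₀ : JetBundle π) (i : Fin (n + 1)) :
    OpenPartialHomeomorph (JetBundle π) (JModel n) where
  toFun u := (chartAt (E1 n) u₀.1.1 u.1.1, dropL i (tmChart u₀.1.1 u.1).2)
  invFun := jetChartInv π u₀ i
  source := {u | u.1.1 ∈ (chartAt (E1 n) u₀.1.1).source ∧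
    chartAt (E1 n) u₀.1.1 u.1.1 ∈ π.good u₀.1.1 i}
  target := π.good u₀.1.1 i ×ˢ Set.univ
  map_source' u hu := ⟨hu.2, trivial⟩
  map_target' p hp := by
    have h : (jetChartInv π u₀ i p).1.1 = (chartAt (E1 n) u₀.1.1).symm p.1 := by
      rw [jetChartInv_coe π u₀ i p hp.1, tmChart_symm_fst]
    refine ⟨?_, ?_⟩
    · rw [h]; exact (chartAt (E1 n) u₀.1.1).map_target hp.1.1
    · rw [h, (chartAt (E1 n) u₀.1.1).right_inv hp.1.1]; exact hp.1
  left_inv' u hu := by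
    refine JetBundle.ext_toTM ?_
    rw [jetChartInv_coe π u₀ i _ hu.2]
    dsimp only
    rw [π.fill_eq u₀.1.1 i u hu.1 hu.2]
    exact (tmChart u₀.1.1).left_inv ((mem_tmChart_source _ _).2 hu.1)
  right_inv' p hp := by
    rw [jetChartInv_coe π u₀ i p hp.1, (tmChart u₀.1.1).right_inv
      ((mem_tmChart_target _ _).2 hp.1.1), tmChart_symm_fst,
      (chartAt (E1 n) u₀.1.1).right_inv hp.1.1, drop_fill]
  open_source := by
    have h1 : IsOpen ((chartAt (E1 n) u₀.1.1).source ∩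
        (chartAt (E1 n) u₀.1.1) ⁻¹' (π.good u₀.1.1 i)) :=
      (chartAt (E1 n) u₀.1.1).isOpen_inter_preimage (π.isOpen_good _ _)
    exact h1.preimage ((FiberBundle.continuous_proj (E1 n)
      (TangentSpace (𝓡 (n + 1)) : M → Type _)).comp (continuous_toTM π))
  open_target := (π.isOpen_good _ i).prod isOpen_univ
  continuousOn_toFun := by
    have h : ContinuousOn (fun u : JetBundle π => tmChart u₀.1.1 u.1)
        {u | u.1.1 ∈ (chartAt (E1 n) u₀.1.1).source ∧
          chartAt (E1 n) u₀.1.1 u.1.1 ∈ π.good u₀.1.1 i} :=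
      (tmChart u₀.1.1).continuousOn.comp (continuous_toTM π).continuousOn
        fun u hu => (mem_tmChart_source _ _).2 hu.1
    exact h.fst.prodMk ((dropL i).continuous.comp_continuousOn h.snd)
  continuousOn_invFun := by
    rw [continuousOn_iff_continuous_domRestrict, continuous_induced_rng]
    refine (continuousOn_iff_continuous_domRestrict
      (f := fun p => (jetChartInv π u₀ i p).toTM)).1 ?_
    have h : ContinuousOn (fun p : JModel n =>
        (tmChart u₀.1.1).symm (p.1, fill i (π.loc u₀.1.1 p.1) p.2)) (π.good u₀.1.1 i ×ˢ Set.univ) :=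
      (tmChart u₀.1.1).continuousOn_symm.comp
        (continuousOn_fst.prodMk (π.contDiffOn_fill u₀.1.1 i).continuousOn)
        fun p hp => (mem_tmChart_target _ _).2 hp.1.1
    exact h.congr fun p hp => jetChartInv_coe π u₀ i p hp.1

theorem mem_jetChart_source (π : TimeFibration n M) (u₀ : JetBundle π) (i : Fin (n + 1))
    (u : JetBundle π) : u ∈ (jetChart π u₀ i).source ↔
      u.1.1 ∈ (chartAt (E1 n) u₀.1.1).source ∧
        chartAt (E1 n) u₀.1.1 u.1.1 ∈ π.good u₀.1.1 i := Iff.rfl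

theorem jetChart_apply (π : TimeFibration n M) (u₀ : JetBundle π) (i : Fin (n + 1))
    (u : JetBundle π) : jetChart π u₀ i u =
      (chartAt (E1 n) u₀.1.1 u.1.1, dropL i (tmChart u₀.1.1 u.1).2) := rfl

theorem mem_jetChart_target (π : TimeFibration n M) (u₀ : JetBundle π) (i : Fin (n + 1))
    (p : JModel n) : p ∈ (jetChart π u₀ i).target ↔ p.1 ∈ π.good u₀.1.1 i :=
  ⟨fun h => h.1, fun h => ⟨h, trivial⟩⟩

theorem jetChart_symm_coe (π : TimeFibration n M) (u₀ : JetBundle π) (i : Fin (n + 1))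
    (p : JModel n) (hp : p.1 ∈ π.good u₀.1.1 i) :
    ((jetChart π u₀ i).symm p).1 = (tmChart u₀.1.1).symm (p.1, fill i (π.loc u₀.1.1 p.1) p.2) :=
  jetChartInv_coe π u₀ i p hp

/-- The index of the coordinate dropped in the preferred chart at `u`. -/
def jetIndex (π : TimeFibration n M) (u : JetBundle π) : Fin (n + 1) :=
  (π.exists_index u.1.1).choose

instance (π : TimeFibration n M) : ChartedSpace (JModel n) (JetBundle π) where
  atlas := Set.range fun q : JetBundle π × Fin (n + 1) => jetChart π q.1 q.2
  chartAt u := jetChart π u (jetIndex π u)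
  mem_chart_source u := ⟨mem_chart_source _ _, mem_chart_target _ _,
    (π.exists_index u.1.1).choose_spec⟩
  chart_mem_atlas u := ⟨(u, jetIndex π u), rfl⟩

theorem contDiffOn_tmChart_change (m m' : M) :
    ContDiffOn ℝ ∞ (F := E1 n × E1 n) (fun p : E1 n × E1 n => tmChart m' ((tmChart m).symm p))
      {p | p ∈ (tmChart m).target ∧ (tmChart m).symm p ∈ (tmChart m').source} := by
  have h := contDiffOn_ext_coord_change (n := ∞) (I := (𝓡 (n + 1)).tangent)
    (⟨m', 0⟩ : TangentBundle (𝓡 (n + 1)) M) ⟨m, 0⟩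
  refine h.mono fun p hp => ?_
  rw [ext_coord_change_source]
  exact ⟨p, ⟨hp.1, hp.2⟩, rfl⟩

instance (π : TimeFibration n M) : IsManifold 𝓘(ℝ, JModel n) ∞ (JetBundle π) := by
  refine isManifold_of_contDiffOn _ _ _ ?_
  rintro _ _ ⟨⟨u, i⟩, rfl⟩ ⟨⟨v, j⟩, rfl⟩
  have h1 : ContDiffOn ℝ ∞ (fun p : JModel n => ((p.1, fill i (π.loc u.1.1 p.1) p.2) : E1 n × E1 n))
      (π.good u.1.1 i ×ˢ Set.univ) := contDiffOn_fst.prodMk (π.contDiffOn_fill _ _)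
  have hsub : ∀ p ∈ ((jetChart π u i).symm ≫ₕ jetChart π v j).source, p.1 ∈ π.good u.1.1 i ∧
      ((p.1, fill i (π.loc u.1.1 p.1) p.2) : E1 n × E1 n) ∈ (tmChart u.1.1).target ∧
      (tmChart u.1.1).symm (p.1, fill i (π.loc u.1.1 p.1) p.2) ∈ (tmChart v.1.1).source := by
    intro p hp
    rw [OpenPartialHomeomorph.trans_source] at hp
    have hp1 : p.1 ∈ π.good u.1.1 i := (mem_jetChart_target π u i p).1 hp.1
    refine ⟨hp1, (mem_tmChart_target _ _).2 hp1.1, (mem_tmChart_source _ _).2 ?_⟩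
    have := ((mem_jetChart_source π v j _).1 hp.2).1
    rwa [jetChart_symm_coe π u i p hp1] at this
  have h2 := (contDiffOn_tmChart_change u.1.1 v.1.1).comp
    (h1.mono fun p hp => ⟨(hsub p hp).1, trivial⟩) (fun p hp => (hsub p hp).2)
  have h3 := h2.fst.prodMk ((dropL j).contDiff.comp_contDiffOn h2.snd)
  have heq : ∀ p ∈ ((jetChart π u i).symm ≫ₕ jetChart π v j).source,
      ((jetChart π u i).symm ≫ₕ jetChart π v j) p =
      ((tmChart v.1.1 ((tmChart u.1.1).symm (p.1, fill i (π.loc u.1.1 p.1) p.2))).1,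
        dropL j (tmChart v.1.1 ((tmChart u.1.1).symm (p.1, fill i (π.loc u.1.1 p.1) p.2))).2) := by
    intro p hp
    rw [OpenPartialHomeomorph.coe_trans, Function.comp_apply, jetChart_apply,
      jetChart_symm_coe π u i p (hsub p hp).1]
    rfl
  simpa using h3.congr heq

theorem triv_eq_mfderiv {E N : Type*} [NormedAddCommGroup E] [NormedSpace ℝ E] [TopologicalSpace N]
    [ChartedSpace E N] [IsManifold 𝓘(ℝ, E) 1 N] (x₀ x : N) (hx : x ∈ (chartAt E x₀).source)
    (w : TangentSpace 𝓘(ℝ, E) x) :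
    (trivializationAt E (TangentSpace 𝓘(ℝ, E)) x₀ (⟨x, w⟩ : TangentBundle 𝓘(ℝ, E) N)).2 =
      mfderiv 𝓘(ℝ, E) 𝓘(ℝ, E) (chartAt E x₀) x w :=
  (congrArg (fun r : TangentBundle 𝓘(ℝ, E) E => (r.2 : E))
    (tangentMap_chart (I := 𝓘(ℝ, E)) (p := (⟨x₀, 0⟩ : TangentBundle 𝓘(ℝ, E) N))
      (q := ⟨x, w⟩) hx)).symm

/-- The `1`-jet `j¹_t γ`, as a point of `J¹π`, of a local section `γ` of `π` defined near `t`. -/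
def jet (π : TimeFibration n M) (γ : ℝ → M) (t : ℝ)
    (hγ : ContMDiffAt 𝓘(ℝ, ℝ) (𝓡 (n + 1)) ∞ γ t) (hs : ∀ᶠ s in nhds t, π.toFun (γ s) = s) :
    JetBundle π where
  toTM := tangentMap 𝓘(ℝ, ℝ) (𝓡 (n + 1)) γ ⟨t, (1 : ℝ)⟩
  dt_toTM := by
    have h1 : MDifferentiableAt 𝓘(ℝ, ℝ) (𝓡 (n + 1)) γ t := hγ.mdifferentiableAt (by simp)
    have h2 : MDifferentiableAt (𝓡 (n + 1)) 𝓘(ℝ, ℝ) π.toFun (γ t) :=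
      π.contMDiff.mdifferentiableAt (by simp)
    have h3 := mfderiv_comp t h2 h1
    have h4 : π.toFun ∘ γ =ᶠ[nhds t] id := hs
    rw [h4.mfderiv_eq, mfderiv_id] at h3
    exact (congrArg (fun L : ℝ →L[ℝ] ℝ => L 1) h3).symm

/-- Every point of `J¹π` is the `1`-jet of a local section. -/
theorem exists_jet_eq (π : TimeFibration n M) (u : JetBundle π) :
    ∃ γ t hγ hs, jet π γ t hγ hs = u := by
  obtain ⟨⟨m, v⟩, hu⟩ := u
  set φ := chartAt (E1 n) m with hφ
  set x := φ m with hx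
  set y : E1 n := (tmChart m (⟨m, v⟩ : TangentBundle (𝓡 (n + 1)) M)).2 with hy
  set f : ℝ → ℝ := fun s => π.toFun (φ.symm (x + s • y)) with hf
  have hxt : x ∈ φ.target := φ.map_source (mem_chart_source _ m)
  have hl : ContDiff ℝ ∞ (fun s : ℝ => x + s • y) := by fun_prop
  have hl0 : x + (0 : ℝ) • y = x := by simp
  have hp : ContDiffAt ℝ ∞ (π.toFun ∘ φ.symm) x :=
    (π.contDiffOn_comp_symm m).contDiffAt (φ.open_target.mem_nhds hxt)
  have hfc : ContDiffAt ℝ ∞ f 0 :=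
    ContDiffAt.comp (0 : ℝ) (g := π.toFun ∘ φ.symm) (by rw [hl0]; exact hp) hl.contDiffAt
  have hf' : HasDerivAt f 1 0 := by
    have h1 : HasDerivAt (fun s : ℝ => x + s • y) y 0 := by
      simpa using ((hasDerivAt_id (0 : ℝ)).smul_const y).const_add x
    have h2 : HasFDerivAt (π.toFun ∘ φ.symm) (π.loc m x) (x + (0 : ℝ) • y) := by
      rw [hl0]; exact (hp.differentiableAt (by simp)).hasFDerivAt
    have h3 := h2.comp_hasDerivAt (0 : ℝ) h1
    have h4 := π.dt_eq_loc m ⟨m, v⟩ (mem_chart_source _ m)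
    rw [hu] at h4
    rw [show (1 : ℝ) = π.loc m x y from h4]
    exact h3
  have hfe : HasFDerivAt f ((ContinuousLinearEquiv.refl ℝ ℝ : ℝ ≃L[ℝ] ℝ) : ℝ →L[ℝ] ℝ) 0 := 
    hf'.hasFDerivAt.congr_fderiv (by ext; simp)
  set e := hfc.toOpenPartialHomeomorph f hfe (by simp) with he
  have hef : (e : ℝ → ℝ) = f := rfl
  have h0s : (0 : ℝ) ∈ e.source := hfc.mem_toOpenPartialHomeomorph_source hfe (by simp)
  set t := f 0 with ht
  have htt : t ∈ e.target := e.map_source h0s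
  have hσ0 : e.symm t = 0 := e.left_inv h0s
  have hσc : ContDiffAt ℝ ∞ e.symm t := hfc.to_localInverse hfe (by simp)
  have hσ' : HasDerivAt e.symm 1 t := by
    have := e.hasDerivAt_symm htt one_ne_zero (by rw [hσ0]; exact hf')
    simpa using this
  have hk : ContDiffAt ℝ ∞ (fun s => x + e.symm s • y) t := by fun_prop
  have hk0 : x + e.symm t • y = x := by rw [hσ0, hl0]
  have hk' : HasDerivAt (fun s => x + e.symm s • y) y t := by
    simpa using (hσ'.smul_const y).const_add x
  have hev : ∀ᶠ s in nhds t, x + e.symm s • y ∈ φ.target := by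
    refine hk.continuousAt.eventually_mem ?_
    rw [hk0]; exact φ.open_target.mem_nhds hxt
  have hγ : ContMDiffAt 𝓘(ℝ, ℝ) (𝓡 (n + 1)) ∞ (fun s => φ.symm (x + e.symm s • y)) t := by
    refine ContMDiffAt.comp t (I' := 𝓡 (n + 1)) ?_ hk.contMDiffAt
    rw [hk0]
    exact contMDiffOn_chart_symm.contMDiffAt (φ.open_target.mem_nhds hxt)
  refine ⟨fun s => φ.symm (x + e.symm s • y), t, hγ, ?_, ?_⟩
  · filter_upwards [e.open_target.mem_nhds htt] with s hs
    exact e.right_inv hs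
  · refine JetBundle.ext_toTM ?_
    refine (tmChart m).injOn ?_ ((mem_tmChart_source _ _).2 (mem_chart_source _ m)) ?_
    · rw [mem_tmChart_source]
      change φ.symm (x + e.symm t • y) ∈ _
      rw [hk0]; exact φ.map_target hxt
    · have hgm : φ.symm (x + e.symm t • y) ∈ φ.source := by rw [hk0]; exact φ.map_target hxt
      have h1 : MDifferentiableAt (𝓡 (n + 1)) (𝓡 (n + 1)) φ (φ.symm (x + e.symm t • y)) :=
        mdifferentiableAt_atlas (chart_mem_atlas _ _) hgm
      have h2 := mfderiv_comp t h1 (hγ.mdifferentiableAt (by simp))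
      have h3 : (φ : M → E1 n) ∘ (fun s => φ.symm (x + e.symm s • y)) =ᶠ[nhds t]
          fun s => x + e.symm s • y := by
        filter_upwards [hev] with s hs
        exact φ.right_inv hs
      rw [h3.mfderiv_eq, mfderiv_eq_fderiv, hk'.hasFDerivAt.fderiv] at h2
      have h4 := congrArg (fun L : ℝ →L[ℝ] E1 n => L 1) h2
      have h5 := triv_eq_mfderiv (N := M) m _ hgm
        (mfderiv 𝓘(ℝ, ℝ) (𝓡 (n + 1)) (fun s => φ.symm (x + e.symm s • y)) t (1 : ℝ))
      refine Prod.ext ?_ ?_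
      · change φ (φ.symm (x + e.symm t • y)) = φ m
        rw [hk0, φ.right_inv hxt]
      · refine h5.trans (h4.symm.trans ?_)
        simp [hy]

/-- The projection `π₁₀ : J¹π → M`, `j¹_t γ ↦ γ(t)`. -/
def pi10 (π : TimeFibration n M) (u : JetBundle π) : M := u.toTM.1

theorem contMDiff_pi10 (π : TimeFibration n M) :
    ContMDiff 𝓘(ℝ, JModel n) (𝓡 (n + 1)) ∞ (pi10 π) := by
  intro u
  have h1 : ContMDiffOn 𝓘(ℝ, JModel n) 𝓘(ℝ, JModel n) ∞ (chartAt (JModel n) u)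
      (chartAt (JModel n) u).source := contMDiffOn_chart
  have h2 : ContMDiffOn 𝓘(ℝ, JModel n) 𝓘(ℝ, E1 n) ∞ (fun v => (chartAt (JModel n) u v).1)
      (chartAt (JModel n) u).source :=
    (contDiff_fst (𝕜 := ℝ) (E := E1 n) (F := EuclideanSpace ℝ (Fin n))).contMDiff.comp_contMDiffOn h1
  have h3 := (contMDiffOn_chart_symm (I := 𝓡 (n + 1)) (n := ∞) (x := pi10 π u)).comp h2
    (fun v hv => (chartAt (E1 n) (pi10 π u)).map_source hv.1)
  refine (h3.congr fun v hv => ?_).contMDiffAt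
    ((chartAt (JModel n) u).open_source.mem_nhds (mem_chart_source _ u))
  exact ((chartAt (E1 n) (pi10 π u)).left_inv hv.1).symm

/-- The tangent map `T_u J¹π → T_m M` of `π₁₀`. -/
def dpi10 (π : TimeFibration n M) (u : JetBundle π) :
    TangentSpace 𝓘(ℝ, JModel n) u →L[ℝ] TangentSpace (𝓡 (n + 1)) (pi10 π u) :=
  mfderiv 𝓘(ℝ, JModel n) (𝓡 (n + 1)) (pi10 π) u

/-- The velocity `γ'(t) ∈ T_m M` of a jet `u = j¹_t γ`. -/
def vel (π : TimeFibration n M) (u : JetBundle π) : TangentSpace (𝓡 (n + 1)) (pi10 π u) := u.toTM.2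

theorem dt_vel (π : TimeFibration n M) (u : JetBundle π) : π.dt (pi10 π u) (vel π u) = 1 :=
  u.dt_toTM

/-- The fibres of `π₁₀` are affine spaces: the translate of `u` by a tangent vector `k` of `M` with
`dt(k) = 0`. -/
def translate (π : TimeFibration n M) (u : JetBundle π) (k : TangentSpace (𝓡 (n + 1)) (pi10 π u))
    (hk : π.dt (pi10 π u) k = 0) : JetBundle π where
  toTM := ⟨pi10 π u, vel π u + k⟩
  dt_toTM := by rw [map_add, hk, add_zero]; exact dt_vel π u

/-- The contact part `(dxⁱ - yⁱ dt)(w) ∂/∂xⁱ` of a tangent vector `w` of `J¹π` at `u`. -/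
def contact (π : TimeFibration n M) (u : JetBundle π) (w : TangentSpace 𝓘(ℝ, JModel n) u) :
    TangentSpace (𝓡 (n + 1)) (pi10 π u) :=
  dpi10 π u w - π.dt (pi10 π u) (dpi10 π u w) • vel π u

theorem dt_contact (π : TimeFibration n M) (u : JetBundle π)
    (w : TangentSpace 𝓘(ℝ, JModel n) u) (s : ℝ) :
    π.dt (pi10 π u) (s • contact π u w) = 0 := by
  rw [contact, map_smul, map_sub, map_smul, dt_vel]; simp

/-- The vertical endomorphism `J = ∂/∂yⁱ ⊗ (dxⁱ - yⁱ dt)` at a point `u`: the vector `J(w)` is the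
velocity at `s = 0` of the line `s ↦ u + s k` in the fibre of `π₁₀`, where `k` is the contact part
of `w`. -/
def vertEndoAt (π : TimeFibration n M) (u : JetBundle π) (w : TangentSpace 𝓘(ℝ, JModel n) u) :
    TangentSpace 𝓘(ℝ, JModel n) u :=
  mfderiv 𝓘(ℝ, ℝ) 𝓘(ℝ, JModel n)
    (fun s : ℝ => translate π u (s • contact π u w) (dt_contact π u w s)) 0 (1 : ℝ)

/-! Coordinate expression of the vertical endomorphism. -/

theorem tmChart_snd_add (m m' : M) (v w : TangentSpace (𝓡 (n + 1)) m') :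
    (tmChart m (⟨m', v + w⟩ : TangentBundle (𝓡 (n + 1)) M)).2 =
      (tmChart m (⟨m', v⟩ : TangentBundle (𝓡 (n + 1)) M)).2 +
      (tmChart m (⟨m', w⟩ : TangentBundle (𝓡 (n + 1)) M)).2 :=
  map_add ((tangentBundleCore (𝓡 (n + 1)) M).coordChange (achart (E1 n) m') (achart (E1 n) m) m') v w

theorem tmChart_snd_smul (m m' : M) (c : ℝ) (w : TangentSpace (𝓡 (n + 1)) m') :
    (tmChart m (⟨m', c • w⟩ : TangentBundle (𝓡 (n + 1)) M)).2 =
      c • (tmChart m (⟨m', w⟩ : TangentBundle (𝓡 (n + 1)) M)).2 :=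
  map_smul ((tangentBundleCore (𝓡 (n + 1)) M).coordChange (achart (E1 n) m') (achart (E1 n) m) m') c w

theorem tmChart_dpi10 (π : TimeFibration n M) (u₀ u : JetBundle π)
    (hu : u ∈ (chartAt (JModel n) u₀).source) (w : TangentSpace 𝓘(ℝ, JModel n) u) :
    (tmChart (pi10 π u₀) (⟨pi10 π u, dpi10 π u w⟩ : TangentBundle (𝓡 (n + 1)) M)).2 =
    (trivializationAt (JModel n) (TangentSpace 𝓘(ℝ, JModel n)) u₀
      (⟨u, w⟩ : TangentBundle 𝓘(ℝ, JModel n) (JetBundle π))).2.1 := by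
  have hbase : pi10 π u ∈ (chartAt (E1 n) (pi10 π u₀)).source := hu.1
  have h1 := triv_eq_mfderiv (N := M) (pi10 π u₀) (pi10 π u) hbase (dpi10 π u w)
  have hc : MDifferentiableAt (𝓡 (n + 1)) (𝓡 (n + 1)) (chartAt (E1 n) (pi10 π u₀)) (pi10 π u) :=
    mdifferentiableAt_atlas (chart_mem_atlas _ _) hbase
  have hp : MDifferentiableAt 𝓘(ℝ, JModel n) (𝓡 (n + 1)) (pi10 π) u :=
    (contMDiff_pi10 π).mdifferentiableAt (by simp)
  have hcd : MDifferentiableAt 𝓘(ℝ, JModel n) 𝓘(ℝ, JModel n) (chartAt (JModel n) u₀) u :=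
    mdifferentiableAt_atlas (chart_mem_atlas _ _) hu
  have hfst : MDifferentiableAt 𝓘(ℝ, JModel n) 𝓘(ℝ, E1 n) (Prod.fst : JModel n → E1 n)
      (chartAt (JModel n) u₀ u) :=
    (ContinuousLinearMap.fst ℝ (E1 n) (EuclideanSpace ℝ (Fin n))).differentiableAt.mdifferentiableAt
  have e1 := mfderiv_comp u hc hp
  have e2 := mfderiv_comp u hfst hcd
  have e3 : (chartAt (E1 n) (pi10 π u₀) : M → E1 n) ∘ pi10 π =
      (Prod.fst : JModel n → E1 n) ∘ (chartAt (JModel n) u₀) := rfl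
  rw [e3] at e1
  rw [e1, mfderiv_eq_fderiv, fderiv_fst] at e2
  rw [triv_eq_mfderiv u₀ u hu]
  have e4 := congrArg (fun L : JModel n →L[ℝ] E1 n => L w) e2
  exact h1.trans e4

theorem triv_vertEndoAt (π : TimeFibration n M) (u₀ u : JetBundle π)
    (hu : u ∈ (chartAt (JModel n) u₀).source) (w : TangentSpace 𝓘(ℝ, JModel n) u) :
    (trivializationAt (JModel n) (TangentSpace 𝓘(ℝ, JModel n)) u₀
      (⟨u, vertEndoAt π u w⟩ : TangentBundle 𝓘(ℝ, JModel n) (JetBundle π))).2 =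
    ((0 : E1 n), dropL (jetIndex π u₀)
      (tmChart (pi10 π u₀) (⟨pi10 π u, contact π u w⟩ : TangentBundle (𝓡 (n + 1)) M)).2) := by
  set i := jetIndex π u₀
  set b : E1 n := (tmChart (pi10 π u₀)
    (⟨pi10 π u, contact π u w⟩ : TangentBundle (𝓡 (n + 1)) M)).2 with hb
  set κ : ℝ → JetBundle π := fun s => translate π u (s • contact π u w) (dt_contact π u w s) with hκ
  set l : ℝ → JModel n := fun s => (chartAt (JModel n) u₀ u).1 |> fun x =>
    (x, dropL i (tmChart (pi10 π u₀) u.toTM).2 + s • dropL i b) with hl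
  have hκ0 : κ 0 = u := by
    refine JetBundle.ext_toTM ?_
    simp only [hκ, translate, zero_smul, add_zero]; rfl
  have hsrc : ∀ s, κ s ∈ (chartAt (JModel n) u₀).source := fun s => hu
  have hval : ∀ s, chartAt (JModel n) u₀ (κ s) = l s := by
    intro s
    refine Prod.ext rfl ?_
    change dropL i (tmChart (pi10 π u₀) (⟨pi10 π u, vel π u + s • contact π u w⟩ :
      TangentBundle (𝓡 (n + 1)) M)).2 = _
    rw [tmChart_snd_add, tmChart_snd_smul, map_add, map_smul]
    rfl
  have hl' : HasFDerivAt l ((0 : ℝ →L[ℝ] E1 n).prod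
      ((ContinuousLinearMap.id ℝ ℝ).smulRight (dropL i b))) 0 := by
    refine (hasFDerivAt_const _ _).prodMk ?_
    exact (((hasFDerivAt_id (𝕜 := ℝ) (0 : ℝ)).smul_const (dropL i b)).const_add _)
  have hκl : κ = (chartAt (JModel n) u₀).symm ∘ l := by
    funext s
    rw [Function.comp_apply, ← hval, (chartAt (JModel n) u₀).left_inv (hsrc s)]
  have hκd : MDifferentiableAt 𝓘(ℝ, ℝ) 𝓘(ℝ, JModel n) κ 0 := by
    rw [hκl]
    refine MDifferentiableAt.comp (I' := 𝓘(ℝ, JModel n)) _ ?_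
      hl'.differentiableAt.mdifferentiableAt
    refine mdifferentiableAt_atlas_symm (I := 𝓘(ℝ, JModel n)) (chart_mem_atlas _ _) ?_
    rw [← hval]; exact (chartAt (JModel n) u₀).map_source (hsrc 0)
  have hcd : MDifferentiableAt 𝓘(ℝ, JModel n) 𝓘(ℝ, JModel n) (chartAt (JModel n) u₀) (κ 0) :=
    mdifferentiableAt_atlas (chart_mem_atlas _ _) (hsrc 0)
  have hcomp := mfderiv_comp (0 : ℝ) hcd hκd
  have hfun : (chartAt (JModel n) u₀ : JetBundle π → JModel n) ∘ κ = l := funext hval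
  rw [hfun, mfderiv_eq_fderiv, hl'.fderiv] at hcomp
  have h1 : ((0 : E1 n), dropL i b) = (mfderiv 𝓘(ℝ, JModel n) 𝓘(ℝ, JModel n)
      (chartAt (JModel n) u₀) (κ 0) : JModel n →L[ℝ] JModel n)
        ((mfderiv 𝓘(ℝ, ℝ) 𝓘(ℝ, JModel n) κ 0 : ℝ →L[ℝ] JModel n) 1) := by
    have h0 : ((0 : ℝ →L[ℝ] E1 n).prod
        ((ContinuousLinearMap.id ℝ ℝ).smulRight (dropL i b))) 1 = ((0 : E1 n), dropL i b) := by simp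
    exact h0.symm.trans (congrArg (fun L : ℝ →L[ℝ] JModel n => L 1) hcomp)
  have h2 : ∀ v, v = u → (mfderiv 𝓘(ℝ, JModel n) 𝓘(ℝ, JModel n)
      (chartAt (JModel n) u₀) v : JModel n →L[ℝ] JModel n) = mfderiv 𝓘(ℝ, JModel n)
      𝓘(ℝ, JModel n) (chartAt (JModel n) u₀) u := by
    rintro v rfl; rfl
  rw [h2 _ hκ0] at h1
  rw [triv_eq_mfderiv u₀ u hu]
  exact h1.symm

theorem triv_self {E N : Type*} [NormedAddCommGroup E] [NormedSpace ℝ E] [TopologicalSpace N]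
    [ChartedSpace E N] [IsManifold 𝓘(ℝ, E) 1 N] (x : N) (w : TangentSpace 𝓘(ℝ, E) x) :
    (trivializationAt E (TangentSpace 𝓘(ℝ, E)) x (⟨x, w⟩ : TangentBundle 𝓘(ℝ, E) N)).2 = w :=
  (tangentBundleCore 𝓘(ℝ, E) N).coordChange_self (achart E x) x (mem_chart_source E x) w

theorem contact_add (π : TimeFibration n M) (u : JetBundle π) (v w : TangentSpace 𝓘(ℝ, JModel n) u) :
    contact π u (v + w) = contact π u v + contact π u w := by
  simp only [contact, map_add, add_smul]; abel

theorem contact_smul (π : TimeFibration n M) (u : JetBundle π) (c : ℝ)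
    (w : TangentSpace 𝓘(ℝ, JModel n) u) : contact π u (c • w) = c • contact π u w := by
  simp only [contact, map_smul, smul_sub, smul_smul, smul_eq_mul]

theorem vertEndoAt_eq (π : TimeFibration n M) (u : JetBundle π)
    (w : TangentSpace 𝓘(ℝ, JModel n) u) : vertEndoAt π u w =
    (((0 : E1 n), dropL (jetIndex π u)
      (tmChart (pi10 π u) (⟨pi10 π u, contact π u w⟩ : TangentBundle (𝓡 (n + 1)) M)).2) :
        JModel n) := by
  rw [← triv_vertEndoAt π u u (mem_chart_source _ _), triv_self]

theorem vertEndoAt_add (π : TimeFibration n M) (u : JetBundle π)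
    (v w : TangentSpace 𝓘(ℝ, JModel n) u) :
    vertEndoAt π u (v + w) = vertEndoAt π u v + vertEndoAt π u w := by
  rw [vertEndoAt_eq, vertEndoAt_eq, vertEndoAt_eq, contact_add, tmChart_snd_add, map_add]
  refine (Prod.ext ?_ rfl : (((0 : E1 n), _) : JModel n) = (((0 : E1 n), _) : JModel n) + (((0 : E1 n), _) : JModel n))
  simp

theorem vertEndoAt_smul (π : TimeFibration n M) (u : JetBundle π) (c : ℝ)
    (w : TangentSpace 𝓘(ℝ, JModel n) u) :
    vertEndoAt π u (c • w) = c • vertEndoAt π u w := by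
  rw [vertEndoAt_eq, vertEndoAt_eq, contact_smul, tmChart_snd_smul, map_smul]
  refine (Prod.ext ?_ rfl : (((0 : E1 n), _) : JModel n) = c • (((0 : E1 n), _) : JModel n))
  simp

theorem contDiffOn_vertEndo_coord (π : TimeFibration n M) (u₀ : JetBundle π) :
    ContDiffOn ℝ ∞ (fun q : JModel n × JModel n => (((0 : E1 n), dropL (jetIndex π u₀)
      (q.2.1 - π.loc (pi10 π u₀) q.1.1 q.2.1 •
        fill (jetIndex π u₀) (π.loc (pi10 π u₀) q.1.1) q.1.2)) : JModel n))
      ((π.good (pi10 π u₀) (jetIndex π u₀) ×ˢ Set.univ) ×ˢ Set.univ) := by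
  have h1 : ContDiffOn ℝ ∞ (fun q : JModel n × JModel n => q.2.1)
      ((π.good (pi10 π u₀) (jetIndex π u₀) ×ˢ Set.univ) ×ˢ Set.univ) :=
    (contDiff_fst.comp contDiff_snd).contDiffOn
  have h2 : ContDiffOn ℝ ∞ (fun q : JModel n × JModel n => π.loc (pi10 π u₀) q.1.1)
      ((π.good (pi10 π u₀) (jetIndex π u₀) ×ˢ Set.univ) ×ˢ Set.univ) :=
    (π.contDiffOn_loc (pi10 π u₀)).comp (contDiff_fst.comp contDiff_fst).contDiffOn
      fun q hq => hq.1.1.1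
  have h3 : ContDiffOn ℝ ∞ (fun q : JModel n × JModel n =>
      fill (jetIndex π u₀) (π.loc (pi10 π u₀) q.1.1) q.1.2)
      ((π.good (pi10 π u₀) (jetIndex π u₀) ×ˢ Set.univ) ×ˢ Set.univ) :=
    (π.contDiffOn_fill (pi10 π u₀) (jetIndex π u₀)).comp contDiffOn_fst fun q hq => hq.1
  exact contDiffOn_const.prodMk ((dropL _).contDiff.comp_contDiffOn
    (h1.sub ((h2.clm_apply h1).smul h3)))

theorem contMDiff_vertEndo (π : TimeFibration n M) (X : VecField (JModel n) (JetBundle π)) :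
    ContMDiff 𝓘(ℝ, JModel n) 𝓘(ℝ, JModel n).tangent ∞
      (fun u => Bundle.TotalSpace.mk' (JModel n) u (vertEndoAt π u (X u))) := by
  intro u₀
  rw [Bundle.contMDiffAt_section]
  have hX := (Bundle.contMDiffAt_section (IB := 𝓘(ℝ, JModel n)) u₀).1 (X.contMDiff u₀)
  have hsrc := (chartAt (JModel n) u₀).open_source.mem_nhds (mem_chart_source _ u₀)
  have hc : ContMDiffAt 𝓘(ℝ, JModel n) 𝓘(ℝ, JModel n) ∞ (chartAt (JModel n) u₀) u₀ :=
    contMDiffOn_chart.contMDiffAt hsrc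
  have hg := contDiffOn_vertEndo_coord π u₀
  have hmem : ((chartAt (JModel n) u₀ u₀, (trivializationAt (JModel n)
      (TangentSpace 𝓘(ℝ, JModel n)) u₀ (⟨u₀, X u₀⟩ : TangentBundle 𝓘(ℝ, JModel n) _)).2) :
        JModel n × JModel n) ∈ ((π.good (pi10 π u₀) (jetIndex π u₀) ×ˢ Set.univ) ×ˢ Set.univ :
        Set (JModel n × JModel n)) :=
    ⟨⟨(mem_chart_source (JModel n) u₀).2, trivial⟩, trivial⟩
  have hga := (hg.contDiffAt ((((π.isOpen_good _ _).prod isOpen_univ).prod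
    isOpen_univ).mem_nhds hmem)).contMDiffAt
  refine (ContMDiffAt.comp u₀ (I' := 𝓘(ℝ, JModel n × JModel n)) hga
    (hc.prodMk_space hX)).congr_of_eventuallyEq ?_
  filter_upwards [hsrc] with u hu
  have hbase : pi10 π u ∈ (chartAt (E1 n) (pi10 π u₀)).source := hu.1
  rw [triv_vertEndoAt π u₀ u hu, contact, sub_eq_add_neg, ← neg_smul, tmChart_snd_add,
    tmChart_snd_smul, tmChart_dpi10 π u₀ u hu]
  have h1 := π.dt_eq_loc (pi10 π u₀) ⟨pi10 π u, dpi10 π u (X u)⟩ hbase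
  rw [tmChart_dpi10 π u₀ u hu] at h1
  change π.dt (pi10 π u) (dpi10 π u (X u)) = _ at h1
  have h2 := π.fill_eq (pi10 π u₀) (jetIndex π u₀) u hu.1 hu.2
  rw [h1, neg_smul, ← sub_eq_add_neg]
  change _ = ((0 : E1 n), dropL (jetIndex π u₀) _)
  refine Prod.ext rfl ?_
  change dropL (jetIndex π u₀) (_ - _ • (tmChart (pi10 π u₀) u.toTM).2) = _
  rw [← h2]
  rfl

/-- The vertical endomorphism (tangent structure) `J` of `J¹π`, a tensor field of type `(1,1)`. -/
def vertEndo (π : TimeFibration n M) : EndoField (JModel n) (JetBundle π) where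
  toFun X := ⟨fun u => vertEndoAt π u (X u), contMDiff_vertEndo π X⟩
  map_add' X Y := by ext u; exact vertEndoAt_add π u (X u) (Y u)
  map_smul' f X := by ext u; exact vertEndoAt_smul π u (f u) (X u)

/-- The time function `t = π ∘ π₁₀` on `J¹π`. -/
def time (π : TimeFibration n M) : SmoothFn (JModel n) (JetBundle π) :=
  ⟨fun u => π.toFun (pi10 π u), π.contMDiff.comp (contMDiff_pi10 π)⟩

/-- The `1`-form `dt` on `J¹π`. -/
def dtForm (π : TimeFibration n M) : OneForm (JModel n) (JetBundle π) := extDFun (time π)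

/-- A semispray: a vector field `S` on `J¹π` with `J(S) = 0` and `dt(S) = 1`. -/
def IsSemispray (π : TimeFibration n M) (S : VecField (JModel n) (JetBundle π)) : Prop :=
  vertEndo π S = 0 ∧ dtForm π S = 1

/-- A vector field on `J¹π` is vertical if it takes values in the kernel of `Dπ₁₀`. -/
def IsVertical (π : TimeFibration n M) (X : VecField (JModel n) (JetBundle π)) : Prop :=
  ∀ u, dpi10 π u (X u) = 0

/-- A `1`-form on `J¹π` is semi-basic if it vanishes on vertical vector fields. -/
def IsSemibasic (π : TimeFibration n M) (θ : OneForm (JModel n) (JetBundle π)) : Prop :=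
  ∀ X, IsVertical π X → θ X = 0

/-- The (weak) horizontal projector `h = ½ (Id - L_S J + S ⊗ dt)` induced by a semispray `S`. -/
def horProj (π : TimeFibration n M) (S : VecField (JModel n) (JetBundle π)) :
    EndoField (JModel n) (JetBundle π) :=
  (algebraMap ℝ (SmoothFn (JModel n) (JetBundle π)) 2⁻¹) •
    (LinearMap.id - lieDEndo S (vertEndo π) + tensorEndo S (dtForm π))

end Jets

end JetMech

end

/-!
Write `β = L_S θ - d(θ(S))`, which is `i_S dθ` by Cartan's formula. The theorem compares `β = 0`
(condition 3) with `dβ = 0` (condition 1, as `d ∘ d = 0`) and with `d_h θ = 0`.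

The geometric input is the identity `J[S, V] = -V` for a semispray `S` and a vertical field `V`
(`vertEndo_bracket`), obtained in a chart from the fact that `S` projects to the tautological
velocity. It shows that every vertical field lies in the image of `J`, without partitions of unity,
and, since `ker J` is spanned by `S` and the vertical fields, that `[S, J X]` equals `-X` modulo
`S` and vertical fields. Two consequences carry the argument.

* As `θ` is semi-basic and `d_J`-closed, `dθ(J X, Y) + dθ(X, J Y) = 0`; with `X = S` this makes `β`
  semi-basic. Since also `β(S) = 0`, one finds `dβ(S, J X) = β(X)`, so `β` vanishes as soon as it is
  closed (`IsSemibasic.eq_zero_of_extDOne_eq_zero`).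
* The horizontal projector fixes `θ`, whence `2 d_h θ = dt ∧ β - i_{L_S J} dθ`
  (`IsSemibasic.two_mul_extDWrt_horProj`). Hence `i_S d_h θ = β`, so `d_h θ = 0` implies `β = 0`.
  Conversely, if `β = 0`, then `L_S dθ = d(L_S θ) = 0`, and applying `L_S` to `i_J dθ = 0` leaves
  `i_{L_S J} dθ = 0`; both terms of `2 d_h θ` vanish.
-/

open scoped Manifold ContDiff

noncomputable section

namespace JetMech

/-! ### Vector fields in a chart -/

section LocalExpressions

variable {E : Type*} [NormedAddCommGroup E] [NormedSpace ℝ E]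
variable {N : Type*} [TopologicalSpace N] [ChartedSpace E N] [IsManifold 𝓘(ℝ, E) ∞ N]

/-- The coordinate expression `E → E` of a vector field in the preferred chart at `x₀`, through the
trivialization of the tangent bundle which that chart induces. It is meaningful on the target of
the chart only. -/
def chartRep (x₀ : N) (X : VecField E N) (p : E) : E :=
  (trivializationAt E (TangentSpace 𝓘(ℝ, E)) x₀ (⟨(chartAt E x₀).symm p,
    X ((chartAt E x₀).symm p)⟩ : TangentBundle 𝓘(ℝ, E) N)).2

theorem chartRep_self (x : N) (X : VecField E N) :
    chartRep x X (chartAt E x x) = X x := by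
  rw [chartRep, (chartAt E x).left_inv (mem_chart_source E x)]
  exact triv_self x (X x)

theorem chartRep_eq_mfderiv (x₀ : N) (X : VecField E N) {p : E} (hp : p ∈ (chartAt E x₀).target) :
    chartRep x₀ X p = mfderiv 𝓘(ℝ, E) 𝓘(ℝ, E) (chartAt E x₀) ((chartAt E x₀).symm p)
      (X ((chartAt E x₀).symm p)) :=
  triv_eq_mfderiv x₀ _ ((chartAt E x₀).map_target hp) _

theorem contDiffAt_chartRep (x : N) (X : VecField E N) :
    ContDiffAt ℝ ∞ (chartRep x X) (chartAt E x x) := by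
  have h := (Bundle.contMDiffAt_section (IB := 𝓘(ℝ, E)) x).1 (X.contMDiff x)
  have hs : ContMDiffAt 𝓘(ℝ, E) 𝓘(ℝ, E) ∞ (chartAt E x).symm (chartAt E x x) :=
    contMDiffOn_chart_symm.contMDiffAt ((chartAt E x).open_target.mem_nhds (mem_chart_target E x))
  rw [← (chartAt E x).left_inv (mem_chart_source E x)] at h
  have h' := ContMDiffAt.comp (chartAt E x x) (I' := 𝓘(ℝ, E)) (g := fun y =>
    (trivializationAt E (TangentSpace 𝓘(ℝ, E)) x (⟨y, X y⟩ : TangentBundle 𝓘(ℝ, E) N)).2)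
    (by convert! h using 2; rw [(chartAt E x).left_inv (mem_chart_source E x)]) hs
  exact h'.contDiffAt

theorem contDiffAt_comp_chart_symm (x : N) (f : SmoothFn E N) :
    ContDiffAt ℝ ∞ (f ∘ (chartAt E x).symm) (chartAt E x x) := by
  have hs : ContMDiffAt 𝓘(ℝ, E) 𝓘(ℝ, E) ∞ (chartAt E x).symm (chartAt E x x) :=
    contMDiffOn_chart_symm.contMDiffAt ((chartAt E x).open_target.mem_nhds (mem_chart_target E x))
  exact (ContMDiffAt.comp (chartAt E x x) (I' := 𝓘(ℝ, E)) (f.contMDiff _) hs).contDiffAt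

theorem derivAlong_chart_symm (x₀ : N) (X : VecField E N) (f : SmoothFn E N) {p : E}
    (hp : p ∈ (chartAt E x₀).target) :
    derivAlong X f ((chartAt E x₀).symm p) =
      fderiv ℝ (f ∘ (chartAt E x₀).symm) p (chartRep x₀ X p) := by
  set φ := chartAt E x₀
  have hx : φ.symm p ∈ φ.source := φ.map_target hp
  have hs : MDifferentiableAt 𝓘(ℝ, E) 𝓘(ℝ, E) φ.symm p :=
    mdifferentiableAt_atlas_symm (chart_mem_atlas _ _) hp
  have hc : MDifferentiableAt 𝓘(ℝ, E) 𝓘(ℝ, E) φ (φ.symm p) :=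
    mdifferentiableAt_atlas (chart_mem_atlas _ _) hx
  have hd : MDifferentiableAt 𝓘(ℝ, E) 𝓘(ℝ, ℝ) (f ∘ φ.symm) (φ (φ.symm p)) := by
    rw [φ.right_inv hp]
    exact MDifferentiableAt.comp (I' := 𝓘(ℝ, E)) p f.mdifferentiableAt hs
  have heq : (f : N → ℝ) =ᶠ[nhds (φ.symm p)] (f ∘ φ.symm) ∘ φ := by
    filter_upwards [φ.open_source.mem_nhds hx] with y hy
    simp [φ.left_inv hy]
  have h1 := mfderiv_comp (φ.symm p) hd hc
  rw [← heq.mfderiv_eq, mfderiv_eq_fderiv, φ.right_inv hp] at h1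
  rw [chartRep_eq_mfderiv x₀ X hp]
  exact congrArg (fun L : E →L[ℝ] ℝ => L (X (φ.symm p))) h1

variable [CompleteSpace E]

/-- In the chart at `x` the Lie bracket is the commutator of the coordinate expressions. -/
theorem bracket_eq_lieBracket (X Y : VecField E N) (x : N) :
    bracket X Y x = VectorField.lieBracket ℝ (chartRep x X) (chartRep x Y) (chartAt E x x) := by
  have key : ∀ Z : VecField E N, VectorField.mpullbackWithin 𝓘(ℝ, E) 𝓘(ℝ, E)
      (extChartAt 𝓘(ℝ, E) x).symm Z (Set.range 𝓘(ℝ, E)) =ᶠ[nhds (chartAt E x x)] chartRep x Z := by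
    intro Z
    filter_upwards [(chartAt E x).open_target.mem_nhds (mem_chart_target E x)] with p hp
    have hp' : p ∈ (extChartAt 𝓘(ℝ, E) x).target := by simpa using hp
    have : IsManifold 𝓘(ℝ, E) 1 N := inferInstance
    rw [VectorField.mpullbackWithin_apply, chartRep_eq_mfderiv x Z hp]
    have h1 := mfderiv_extChartAt_comp_mfderivWithin_extChartAt_symm (I := 𝓘(ℝ, E)) hp'
    have h2 := mfderivWithin_extChartAt_symm_comp_mfderiv_extChartAt (I := 𝓘(ℝ, E)) hp'
    have h3 := ContinuousLinearMap.inverse_eq h2 h1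
    have h4 := congrArg (fun L : E →L[ℝ] E => L (Z ((chartAt E x).symm p))) h3
    refine Eq.trans h4 ?_
    rfl
  have hid : mfderiv 𝓘(ℝ, E) 𝓘(ℝ, E) (extChartAt 𝓘(ℝ, E) x) x = ContinuousLinearMap.id ℝ E := by
    ext w
    exact (triv_eq_mfderiv x x (mem_chart_source E x) w).symm.trans (triv_self x w)
  change VectorField.mlieBracketWithin 𝓘(ℝ, E) X Y Set.univ x = _
  rw [VectorField.mlieBracketWithin_apply]
  have h5 : VectorField.lieBracketWithin ℝ
      (VectorField.mpullbackWithin 𝓘(ℝ, E) 𝓘(ℝ, E) (extChartAt 𝓘(ℝ, E) x).symm X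
        (Set.range 𝓘(ℝ, E)))
      (VectorField.mpullbackWithin 𝓘(ℝ, E) 𝓘(ℝ, E) (extChartAt 𝓘(ℝ, E) x).symm Y
        (Set.range 𝓘(ℝ, E)))
      ((extChartAt 𝓘(ℝ, E) x).symm ⁻¹' Set.univ ∩ Set.range 𝓘(ℝ, E)) (chartAt E x x) =
      VectorField.lieBracket ℝ (chartRep x X) (chartRep x Y) (chartAt E x x) := by
    have hu : ((extChartAt 𝓘(ℝ, E) x).symm ⁻¹' Set.univ ∩ Set.range 𝓘(ℝ, E)) = Set.univ := by simp
    have hw : ∀ (V W : E → E) (s : Set E) (p : E), s = Set.univ →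
        VectorField.lieBracketWithin ℝ V W s p = VectorField.lieBracket ℝ V W p := by
      rintro V W _ p rfl; rw [VectorField.lieBracketWithin_univ]
    exact (hw _ _ _ _ hu).trans ((key X).lieBracket_vectorField_eq (key Y))
  have h6 : (mfderiv 𝓘(ℝ, E) 𝓘(ℝ, E) (extChartAt 𝓘(ℝ, E) x) x).inverse =
      ContinuousLinearMap.id ℝ E := by
    rw [hid]; exact ContinuousLinearMap.inverse_id
  exact (congrArg (fun L : E →L[ℝ] E => L _) h6).trans h5

/-- Differentiation along a Lie bracket is the commutator of the differentiations. -/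
theorem derivAlong_bracket (X Y : VecField E N) (f : SmoothFn E N) :
    derivAlong (bracket X Y) f = derivAlong X (derivAlong Y f) - derivAlong Y (derivAlong X f) := by
  ext x
  have hx := mem_chart_target E x
  have hl := (chartAt E x).left_inv (mem_chart_source E x)
  have hrep : ∀ (Z : VecField E N) (g : SmoothFn E N), derivAlong Z g x =
      fderiv ℝ (g ∘ (chartAt E x).symm) (chartAt E x x) (chartRep x Z (chartAt E x x)) := by
    intro Z g
    have := derivAlong_chart_symm x Z g hx
    rwa [hl] at this
  have hev : ∀ Z : VecField E N, (derivAlong Z f ∘ (chartAt E x).symm) =ᶠ[nhds (chartAt E x x)]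
      fun p => fderiv ℝ (f ∘ (chartAt E x).symm) p (chartRep x Z p) := by
    intro Z
    filter_upwards [(chartAt E x).open_target.mem_nhds hx] with p hp
    exact derivAlong_chart_symm x Z f hp
  have h := VectorField.fderiv_apply_lieBracket (contDiffAt_comp_chart_symm x f)
    (by rw [minSmoothness_of_isRCLikeNormedField]; exact ENat.LEInfty.out)
    ((contDiffAt_chartRep x Y).differentiableAt (by simp))
    ((contDiffAt_chartRep x X).differentiableAt (by simp))
  change derivAlong (bracket X Y) f x = derivAlong X (derivAlong Y f) x
    - derivAlong Y (derivAlong X f) x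
  rw [hrep, hrep, hrep, (hev Y).fderiv_eq, (hev X).fderiv_eq, chartRep_self, bracket_eq_lieBracket]
  exact h

/-- The Jacobi identity. -/
theorem bracket_bracket (X Y Z : VecField E N) :
    bracket X (bracket Y Z) = bracket (bracket X Y) Z + bracket Y (bracket X Z) := by
  have : IsManifold 𝓘(ℝ, E) (minSmoothness ℝ 3) N := by
    rw [minSmoothness_of_isRCLikeNormedField]; infer_instance
  have h : ∀ W : VecField E N, ContMDiff 𝓘(ℝ, E) 𝓘(ℝ, E).tangent (minSmoothness ℝ 2)
      (fun x => Bundle.TotalSpace.mk' E x (W x)) := fun W => W.contMDiff.of_le (by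
    rw [minSmoothness_of_isRCLikeNormedField]; exact ENat.LEInfty.out)
  ext x
  exact VectorField.leibniz_identity_mlieBracket_apply (h X x) (h Y x) (h Z x)

end LocalExpressions

/-! ### Cartan calculus -/

section Cartan

variable {E : Type*} [NormedAddCommGroup E] [NormedSpace ℝ E] [CompleteSpace E]
variable {N : Type*} [TopologicalSpace N] [ChartedSpace E N] [IsManifold 𝓘(ℝ, E) ∞ N]

theorem extDOne_apply (α : OneForm E N) (X Y : VecField E N) :
    extDOne α X Y = derivAlong X (α Y) - derivAlong Y (α X) - α (bracket X Y) := rfl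

theorem algebraMap_half_mul_two :
    algebraMap ℝ (SmoothFn E N) 2⁻¹ * 2 = 1 := by
  rw [← map_ofNat (algebraMap ℝ (SmoothFn E N)) 2, ← map_mul]
  simp

theorem lieDEndo_apply (X : VecField E N) (A : EndoField E N) (Y : VecField E N) :
    lieDEndo X A Y = bracket X (A Y) - A (bracket X Y) := rfl

theorem derivAlong_zero (X : VecField E N) : derivAlong X 0 = 0 := by
  simpa using derivAlong_add X 0 0

theorem derivAlong_sub (X : VecField E N) (f g : SmoothFn E N) :
    derivAlong X (f - g) = derivAlong X f - derivAlong X g := by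
  have := derivAlong_add X (f - g) g
  rw [sub_add_cancel] at this
  rw [this, add_sub_cancel_right]

theorem derivAlong_one (X : VecField E N) : derivAlong X 1 = 0 := by
  simpa using derivAlong_mul X 1 1

theorem bracket_self (X : VecField E N) : bracket X X = 0 := by
  ext x
  exact congrFun (VectorField.mlieBracket_self (I := 𝓘(ℝ, E)) (V := (X : ∀ x, TangentSpace _ x))) x

theorem extDOne_swap (α : OneForm E N) (X Y : VecField E N) :
    extDOne α X Y = -extDOne α Y X := by
  rw [extDOne_apply, extDOne_apply, bracket_swap X Y, map_neg]; abel

theorem extDOne_self (α : OneForm E N) (X : VecField E N) : extDOne α X X = 0 := by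
  rw [extDOne_apply, bracket_self, map_zero]; simp

theorem extDOne_zero : extDOne (0 : OneForm E N) = 0 := by
  refine LinearMap.ext fun X => LinearMap.ext fun Y => ?_
  simp only [extDOne_apply, LinearMap.zero_apply, derivAlong_zero, sub_zero]

theorem extDOne_sub (α β : OneForm E N) : extDOne (α - β) = extDOne α - extDOne β := by
  refine LinearMap.ext fun X => LinearMap.ext fun Y => ?_
  simp only [LinearMap.sub_apply, extDOne_apply, derivAlong_sub]
  abel

/-- `d ∘ d = 0` on functions. -/
theorem extDOne_extDFun (f : SmoothFn E N) : extDOne (extDFun f) = 0 := by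
  refine LinearMap.ext fun X => LinearMap.ext fun Y => ?_
  change derivAlong X (derivAlong Y f) - derivAlong Y (derivAlong X f)
    - derivAlong (bracket X Y) f = 0
  rw [derivAlong_bracket, sub_self]

/-- Cartan's formula `L_S α - d(α(S)) = i_S dα`. -/
theorem lieDOne_sub_extDFun (S : VecField E N) (α : OneForm E N) :
    lieDOne S α - extDFun (α S) = extDOne α S := by
  ext1 Y
  change derivAlong S (α Y) - α (bracket S Y) - derivAlong Y (α S) = _
  rw [extDOne_apply]; abel

/-- The Lie derivative commutes with `d`: `d(L_S α)(X, Y) = (L_S dα)(X, Y)`. -/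
theorem extDOne_lieDOne (S : VecField E N) (α : OneForm E N) (X Y : VecField E N) :
    extDOne (lieDOne S α) X Y = derivAlong S (extDOne α X Y) - extDOne α (bracket S X) Y
      - extDOne α X (bracket S Y) := by
  have hl : ∀ Z, lieDOne S α Z = derivAlong S (α Z) - α (bracket S Z) := fun _ => rfl
  simp only [extDOne_apply, hl, derivAlong_sub, derivAlong_bracket, bracket_bracket S X Y, map_add]
  abel

end Cartan

/-! ### Vertical vectors and the vertical endomorphism -/

section JetGeometry

variable {n : ℕ} {M : Type*} [TopologicalSpace M] [ChartedSpace (E1 n) M]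
  [IsManifold (𝓡 (n + 1)) ∞ M]

theorem tmChart_self (m : M) (v : TangentSpace (𝓡 (n + 1)) m) :
    (tmChart m (⟨m, v⟩ : TangentBundle (𝓡 (n + 1)) M)).2 = v :=
  triv_self (N := M) m v

theorem dpi10_eq_fst (π : TimeFibration n M) (u : JetBundle π)
    (w : TangentSpace 𝓘(ℝ, JModel n) u) : dpi10 π u w = (show JModel n from w).1 := by
  have h := tmChart_dpi10 π u u (mem_chart_source _ u) w
  rw [triv_self, tmChart_self] at h
  exact h

theorem dpi10_vertEndoAt (π : TimeFibration n M) (u : JetBundle π)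
    (w : TangentSpace 𝓘(ℝ, JModel n) u) : dpi10 π u (vertEndoAt π u w) = 0 := by
  rw [dpi10_eq_fst, vertEndoAt_eq]
  rfl

theorem dtForm_apply (π : TimeFibration n M) (X : VecField (JModel n) (JetBundle π))
    (u : JetBundle π) : dtForm π X u = π.dt (pi10 π u) (dpi10 π u (X u)) := by
  have h2 : MDifferentiableAt (𝓡 (n + 1)) 𝓘(ℝ, ℝ) π.toFun (pi10 π u) :=
    π.contMDiff.mdifferentiableAt (by simp)
  have hp : MDifferentiableAt 𝓘(ℝ, JModel n) (𝓡 (n + 1)) (pi10 π) u :=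
    (contMDiff_pi10 π).mdifferentiableAt (by simp)
  exact congrArg (fun L : JModel n →L[ℝ] ℝ => L (X u)) (mfderiv_comp u h2 hp)

/-- The `dropL` coordinates are injective on `ker dt`, because the coordinate dropped is
one along which `π` has non-zero derivative. -/
theorem contact_eq_zero_of_vertEndoAt_eq_zero (π : TimeFibration n M) (u : JetBundle π)
    (w : TangentSpace 𝓘(ℝ, JModel n) u) (h : vertEndoAt π u w = 0) : contact π u w = 0 := by
  rw [vertEndoAt_eq, tmChart_self] at h
  have h1 : dropL (jetIndex π u) (contact π u w) = 0 := congrArg Prod.snd h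
  have h2 : π.loc (pi10 π u) (chartAt (E1 n) (pi10 π u) (pi10 π u)) (contact π u w) = 0 := by
    have h3 := π.dt_eq_loc (pi10 π u) ⟨pi10 π u, contact π u w⟩ (mem_chart_source _ _)
    rw [tmChart_self] at h3
    have h4 := dt_contact π u w 1
    rw [one_smul] at h4
    exact h3.symm.trans h4
  have h5 := ins_drop (jetIndex π u) (contact π u w)
  rw [h1, map_zero, zero_add] at h5
  rw [← h5] at h2
  have h6 := (map_smul (π.loc (pi10 π u) (chartAt (E1 n) (pi10 π u) (pi10 π u))) _ _).symm.trans h2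
  rcases mul_eq_zero.1 h6 with h7 | h7
  · rw [h7, zero_smul] at h5
    exact h5.symm
  · exact absurd h7 (π.exists_index (pi10 π u)).choose_spec

theorem isVertical_vertEndo (π : TimeFibration n M) (X : VecField (JModel n) (JetBundle π)) :
    IsVertical π (vertEndo π X) := fun u => dpi10_vertEndoAt π u (X u)

theorem dtForm_of_isVertical (π : TimeFibration n M) {V : VecField (JModel n) (JetBundle π)}
    (hV : IsVertical π V) : dtForm π V = 0 := by
  ext u
  rw [dtForm_apply, hV u, map_zero]; rfl

/-- The integral curves of a semispray are prolongations of curves in `M`: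
`Dπ₁₀(S)` is the tautological velocity. -/
theorem dpi10_semispray (π : TimeFibration n M) {S : VecField (JModel n) (JetBundle π)}
    (hS : IsSemispray π S) (u : JetBundle π) : dpi10 π u (S u) = vel π u := by
  have h := contact_eq_zero_of_vertEndoAt_eq_zero π u (S u) (congrArg (fun Z => Z u) hS.1)
  have h1 : π.dt (pi10 π u) (dpi10 π u (S u)) = 1 := by
    rw [← dtForm_apply, hS.2]; rfl
  rw [contact, h1, one_smul, sub_eq_zero] at h
  exact h

/-- The kernel of `J` is spanned by `S` and the vertical vectors. -/
theorem isVertical_sub_smul_semispray (π : TimeFibration n M)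
    {S : VecField (JModel n) (JetBundle π)} (hS : IsSemispray π S)
    {Z : VecField (JModel n) (JetBundle π)} (hZ : vertEndo π Z = 0) :
    IsVertical π (Z - dtForm π Z • S) := by
  intro u
  have h := contact_eq_zero_of_vertEndoAt_eq_zero π u (Z u) (congrArg (fun Z => Z u) hZ)
  change dpi10 π u (Z u - dtForm π Z u • S u) = 0
  rw [map_sub, map_smul, dpi10_semispray π hS, dtForm_apply]
  exact h

theorem dtForm_bracket (π : TimeFibration n M) {S V : VecField (JModel n) (JetBundle π)}
    (hS : IsSemispray π S) (hV : IsVertical π V) : dtForm π (bracket S V) = 0 := by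
  have h := derivAlong_bracket S V (time π)
  have hs : derivAlong S (time π) = 1 := hS.2
  have hv : derivAlong V (time π) = 0 := dtForm_of_isVertical π hV
  rw [hs, hv, derivAlong_zero, derivAlong_one, sub_zero] at h
  exact h

/-- `J[S, V] = -V` for vertical `V`. In the coordinates `(x, y)` of a chart, where `dropL` forgets
the velocity coordinate which `dt = 1` determines, `S` has `x`-components whose `dropL` part is `y`,
and `V` has vanishing `x`-components, so that the `dropL` part of the `x`-components of `[S, V]` is
the derivative of `-y` along `V`. -/
theorem vertEndo_bracket (π : TimeFibration n M) {S V : VecField (JModel n) (JetBundle π)}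
    (hS : IsSemispray π S) (hV : IsVertical π V) : vertEndo π (bracket S V) = -V := by
  ext1 u
  change vertEndoAt π u (bracket S V u) = -V u
  set i := jetIndex π u
  set p₀ : JModel n := chartAt (JModel n) u u with hp₀
  have hmem := (chartAt (JModel n) u).open_target.mem_nhds (mem_chart_target (JModel n) u)
  have hVx : (fun p => (chartRep u V p).1) =ᶠ[nhds p₀] fun _ => (0 : E1 n) := by
    filter_upwards [hmem] with p hp
    have hs := (chartAt (JModel n) u).map_target hp
    refine (tmChart_dpi10 π u _ hs (V _)).symm.trans ?_
    rw [hV]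
    exact map_zero ((tangentBundleCore (𝓡 (n + 1)) M).coordChange _ _ _)
  have hSx : (fun p => dropL i (chartRep u S p).1) =ᶠ[nhds p₀] Prod.snd := by
    filter_upwards [hmem] with p hp
    have hs := (chartAt (JModel n) u).map_target hp
    have h1 := tmChart_dpi10 π u _ hs (S _)
    rw [dpi10_semispray π hS] at h1
    refine (congrArg (dropL i) h1.symm).trans ?_
    exact congrArg Prod.snd ((chartAt (JModel n) u).right_inv hp)
  have hSd := (contDiffAt_chartRep u S).differentiableAt (by simp)
  have hVd := (contDiffAt_chartRep u V).differentiableAt (by simp)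
  have hb : dropL i (show JModel n from bracket S V u).1 = -(show JModel n from V u).2 := by
    have h1 : ∀ w, (fderiv ℝ (chartRep u V) p₀ w).1 = 0 := fun w =>
      congrArg (fun L : JModel n →L[ℝ] E1 n => L w)
        (hVd.hasFDerivAt.fst.unique ((hasFDerivAt_const (0 : E1 n) p₀).congr_of_eventuallyEq hVx))
    have h2 : ∀ w, dropL i (fderiv ℝ (chartRep u S) p₀ w).1 = w.2 := fun w =>
      congrArg (fun L : JModel n →L[ℝ] EuclideanSpace ℝ (Fin n) => L w)
        (((dropL i).hasFDerivAt.comp p₀ hSd.hasFDerivAt.fst).unique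
          (hasFDerivAt_snd.congr_of_eventuallyEq hSx))
    rw [bracket_eq_lieBracket, ← chartRep_self u V]
    change dropL i ((fderiv ℝ (chartRep u V) p₀ (chartRep u S p₀)).1
      - (fderiv ℝ (chartRep u S) p₀ (chartRep u V p₀)).1) = -(chartRep u V p₀).2
    rw [h1, zero_sub, map_neg, h2]
  rw [vertEndoAt_eq, tmChart_self]
  have hc : contact π u (bracket S V u) = (show JModel n from bracket S V u).1 := by
    have h0 : π.dt (pi10 π u) (dpi10 π u (bracket S V u)) = 0 := by
      rw [← dtForm_apply, dtForm_bracket π hS hV]; rfl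
    rw [contact, h0, zero_smul, sub_zero, dpi10_eq_fst]
  rw [hc]
  refine Prod.ext ?_ hb
  have h1 := hV u
  rw [dpi10_eq_fst] at h1
  change (0 : E1 n) = -(show JModel n from V u).1
  exact (neg_eq_zero.2 h1).symm

end JetGeometry

/-! ### Semi-basic forms and the horizontal projector -/

section SemibasicForms

variable {n : ℕ} {M : Type*} [TopologicalSpace M] [ChartedSpace (E1 n) M]
  [IsManifold (𝓡 (n + 1)) ∞ M]
variable {π : TimeFibration n M} {S : VecField (JModel n) (JetBundle π)}

/-- The field `[S, J X] + X` lies in `ker J`, so it is the sum of `dt(X) S` and a vertical field. -/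
theorem IsSemibasic.apply_bracket_vertEndo (hS : IsSemispray π S)
    {α : OneForm (JModel n) (JetBundle π)} (hα : IsSemibasic π α)
    (X : VecField (JModel n) (JetBundle π)) :
    α (bracket S (vertEndo π X)) = dtForm π X * α S - α X := by
  have hv := isVertical_vertEndo π X
  have hZ : vertEndo π (bracket S (vertEndo π X) + X) = 0 := by
    rw [map_add, vertEndo_bracket π hS hv, neg_add_cancel]
  have h := hα _ (isVertical_sub_smul_semispray π hS hZ)
  rw [map_sub, map_smul, map_add, map_add, dtForm_bracket π hS hv, zero_add, smul_eq_mul] at h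
  linear_combination h

/-- Every vertical field is of the form `J X`, namely with `X = -[S, V]`. -/
theorem isSemibasic_of_apply_vertEndo (hS : IsSemispray π S)
    {α : OneForm (JModel n) (JetBundle π)} (hα : ∀ X, α (vertEndo π X) = 0) :
    IsSemibasic π α := by
  intro V hV
  have h := hα (bracket S V)
  rw [vertEndo_bracket π hS hV, map_neg, neg_eq_zero] at h
  exact h

theorem IsSemibasic.innerOne_vertEndo {θ : OneForm (JModel n) (JetBundle π)}
    (hθ : IsSemibasic π θ) : innerOne (vertEndo π) θ = 0 :=
  LinearMap.ext fun X => hθ _ (isVertical_vertEndo π X)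

/-- For semi-basic `θ` the condition `d_J θ = 0` says that `J` is skew-adjoint for `dθ`. -/
theorem IsSemibasic.extDOne_vertEndo_add {θ : OneForm (JModel n) (JetBundle π)}
    (hθ : IsSemibasic π θ) (hJ : extDWrt (vertEndo π) θ = 0)
    (X Y : VecField (JModel n) (JetBundle π)) :
    extDOne θ (vertEndo π X) Y + extDOne θ X (vertEndo π Y) = 0 := by
  have h := congrArg (fun b => b X Y) hJ
  change extDOne θ (vertEndo π X) Y + extDOne θ X (vertEndo π Y)
    - extDOne (innerOne (vertEndo π) θ) X Y = 0 at h
  rwa [hθ.innerOne_vertEndo, extDOne_zero, LinearMap.zero_apply, LinearMap.zero_apply,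
    sub_zero] at h

theorem isSemibasic_extDOne_semispray (hS : IsSemispray π S)
    {θ : OneForm (JModel n) (JetBundle π)} (hθ : IsSemibasic π θ)
    (hJ : extDWrt (vertEndo π) θ = 0) : IsSemibasic π (extDOne θ S) := by
  refine isSemibasic_of_apply_vertEndo hS fun X => ?_
  have h := hθ.extDOne_vertEndo_add hJ S X
  rwa [hS.1, map_zero, LinearMap.zero_apply, zero_add] at h

/-- A closed semi-basic form annihilated by a semispray vanishes: `dα(S, J X) = α(X)`. -/
theorem IsSemibasic.eq_zero_of_extDOne_eq_zero (hS : IsSemispray π S)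
    {α : OneForm (JModel n) (JetBundle π)} (hα : IsSemibasic π α) (hαS : α S = 0)
    (hd : extDOne α = 0) : α = 0 := by
  refine LinearMap.ext fun X => ?_
  have h : extDOne α S (vertEndo π X) = 0 := by rw [hd]; rfl
  rw [extDOne_apply, hα _ (isVertical_vertEndo π X), hαS, derivAlong_zero, derivAlong_zero,
    hα.apply_bracket_vertEndo hS, hαS] at h
  change α X = 0
  linear_combination h

theorem IsSemibasic.apply_lieDEndo (hS : IsSemispray π S)
    {α : OneForm (JModel n) (JetBundle π)} (hα : IsSemibasic π α)
    (X : VecField (JModel n) (JetBundle π)) :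
    α (lieDEndo S (vertEndo π) X) = dtForm π X * α S - α X := by
  rw [lieDEndo_apply, map_sub, hα.apply_bracket_vertEndo hS, hα _ (isVertical_vertEndo π _),
    sub_zero]

theorem lieDEndo_semispray (hS : IsSemispray π S) : lieDEndo S (vertEndo π) S = 0 := by
  have h : bracket S (0 : VecField (JModel n) (JetBundle π)) = 0 := by
    simpa using bracket_add_right S 0 0
  rw [lieDEndo_apply, hS.1, bracket_self, map_zero, h, sub_zero]

theorem horProj_apply (X : VecField (JModel n) (JetBundle π)) :
    horProj π S X = algebraMap ℝ (SmoothFn (JModel n) (JetBundle π)) 2⁻¹ •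
      (X - lieDEndo S (vertEndo π) X + dtForm π X • S) := rfl

/-- Semi-basic forms are invariant under the horizontal projector: `i_h θ = θ`. -/
theorem IsSemibasic.innerOne_horProj (hS : IsSemispray π S)
    {θ : OneForm (JModel n) (JetBundle π)} (hθ : IsSemibasic π θ) :
    innerOne (horProj π S) θ = θ := by
  refine LinearMap.ext fun X => ?_
  change θ (horProj π S X) = θ X
  rw [horProj_apply, map_smul, map_add, map_sub, map_smul, hθ.apply_lieDEndo hS]
  simp only [smul_eq_mul]
  linear_combination θ X * algebraMap_half_mul_two (E := JModel n) (N := JetBundle π)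

/-- `2 d_h θ = dt ∧ i_S dθ - i_{L_S J} dθ` for semi-basic `θ`. -/
theorem IsSemibasic.two_mul_extDWrt_horProj (hS : IsSemispray π S)
    {θ : OneForm (JModel n) (JetBundle π)} (hθ : IsSemibasic π θ)
    (X Y : VecField (JModel n) (JetBundle π)) :
    2 * extDWrt (horProj π S) θ X Y = dtForm π X * extDOne θ S Y - dtForm π Y * extDOne θ S X
      - (extDOne θ (lieDEndo S (vertEndo π) X) Y + extDOne θ X (lieDEndo S (vertEndo π) Y)) := by
  have h : extDWrt (horProj π S) θ X Y = extDOne θ (horProj π S X) Y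
      + extDOne θ X (horProj π S Y) - extDOne θ X Y := by
    rw [extDWrt, hθ.innerOne_horProj hS]; rfl
  rw [h, horProj_apply, horProj_apply]
  simp only [map_smul, map_add, map_sub, LinearMap.smul_apply, LinearMap.add_apply,
    LinearMap.sub_apply, smul_eq_mul]
  rw [extDOne_swap θ X S]
  linear_combination (2 * extDOne θ X Y
    - extDOne θ (lieDEndo S (vertEndo π) X) Y - extDOne θ X (lieDEndo S (vertEndo π) Y)
    + dtForm π X * extDOne θ S Y - dtForm π Y * extDOne θ S X)
    * algebraMap_half_mul_two (E := JModel n) (N := JetBundle π)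

/-- `i_S d_h θ = i_S dθ`. -/
theorem IsSemibasic.extDWrt_horProj_semispray (hS : IsSemispray π S)
    {θ : OneForm (JModel n) (JetBundle π)} (hθ : IsSemibasic π θ)
    (hJ : extDWrt (vertEndo π) θ = 0) (Y : VecField (JModel n) (JetBundle π)) :
    extDWrt (horProj π S) θ S Y = extDOne θ S Y := by
  have h := hθ.two_mul_extDWrt_horProj hS S Y
  rw [lieDEndo_semispray hS, (isSemibasic_extDOne_semispray hS hθ hJ).apply_lieDEndo hS,
    extDOne_self, hS.2, map_zero, LinearMap.zero_apply] at h
  linear_combination algebraMap ℝ (SmoothFn (JModel n) (JetBundle π)) 2⁻¹ * h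
    + (extDOne θ S Y - extDWrt (horProj π S) θ S Y)
      * algebraMap_half_mul_two (E := JModel n) (N := JetBundle π)

/-- If `d(L_S θ) = 0`, applying `L_S` to `i_J dθ = 0` gives `i_{L_S J} dθ = 0`. -/
theorem IsSemibasic.extDOne_lieDEndo_add {θ : OneForm (JModel n) (JetBundle π)}
    (hθ : IsSemibasic π θ) (hJ : extDWrt (vertEndo π) θ = 0) (hd : extDOne (lieDOne S θ) = 0)
    (X Y : VecField (JModel n) (JetBundle π)) :
    extDOne θ (lieDEndo S (vertEndo π) X) Y + extDOne θ X (lieDEndo S (vertEndo π) Y) = 0 := by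
  have hb : ∀ X Y, derivAlong S (extDOne θ X Y)
      = extDOne θ (bracket S X) Y + extDOne θ X (bracket S Y) := by
    intro X Y
    have h := extDOne_lieDOne S θ X Y
    rw [hd, LinearMap.zero_apply, LinearMap.zero_apply] at h
    linear_combination -h
  have h1 := congrArg (derivAlong S) (hθ.extDOne_vertEndo_add hJ X Y)
  rw [derivAlong_add, hb, hb, derivAlong_zero] at h1
  have h2 := hθ.extDOne_vertEndo_add hJ (bracket S X) Y
  have h3 := hθ.extDOne_vertEndo_add hJ X (bracket S Y)
  rw [lieDEndo_apply, lieDEndo_apply]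
  simp only [map_sub, LinearMap.sub_apply]
  linear_combination h1 - h2 - h3

end SemibasicForms

end JetMech

end

open JetMech in
theorem theorem5p1 {n : ℕ} {M : Type*} [TopologicalSpace M] [T2Space M] [SecondCountableTopology M]
    [ChartedSpace (EuclideanSpace ℝ (Fin (n + 1))) M] [IsManifold (𝓡 (n + 1)) ∞ M]
    (π : JetMech.TimeFibration n M)
    (S : JetMech.VecField (JetMech.JModel n) (JetMech.JetBundle π)) (hS : JetMech.IsSemispray π S)
    (θ : JetMech.OneForm (JetMech.JModel n) (JetMech.JetBundle π))
    (hθ : JetMech.IsSemibasic π θ) (hJ : JetMech.extDWrt (JetMech.vertEndo π) θ = 0) :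
    List.TFAE [
      JetMech.extDOne (JetMech.lieDOne S θ) = 0,
      ∃ f : JetMech.SmoothFn (JetMech.JModel n) (JetMech.JetBundle π),
        JetMech.lieDOne S θ = JetMech.extDFun f,
      JetMech.lieDOne S θ = JetMech.extDFun (θ S),
      JetMech.extDWrt (JetMech.horProj π S) θ = 0] := by
  have hβ : lieDOne S θ = extDFun (θ S) ↔ extDOne θ S = 0 := by
    rw [← lieDOne_sub_extDFun, sub_eq_zero]
  tfae_have 3 → 2 := fun h => ⟨_, h⟩
  tfae_have 2 → 1 := by
    rintro ⟨f, hf⟩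
    rw [hf, extDOne_extDFun]
  tfae_have 1 → 3 := by
    intro h
    refine hβ.2 ((isSemibasic_extDOne_semispray hS hθ hJ).eq_zero_of_extDOne_eq_zero hS
      (extDOne_self θ S) ?_)
    rw [← lieDOne_sub_extDFun, extDOne_sub, h, extDOne_extDFun]
    exact sub_self (0 : BilinForm (JModel n) (JetBundle π))
  tfae_have 4 → 3 := by
    intro h
    refine hβ.2 (LinearMap.ext fun Y => ?_)
    rw [← hθ.extDWrt_horProj_semispray hS hJ, h]
    rfl
  tfae_have 3 → 4 := by
    intro h
    have hd : extDOne (lieDOne S θ) = 0 := by rw [h, extDOne_extDFun]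
    refine LinearMap.ext fun X => LinearMap.ext fun Y => ?_
    have h1 := hθ.two_mul_extDWrt_horProj hS X Y
    rw [hθ.extDOne_lieDEndo_add hJ hd, hβ.1 h, LinearMap.zero_apply, LinearMap.zero_apply] at h1
    rw [LinearMap.zero_apply, LinearMap.zero_apply]
    linear_combination algebraMap ℝ (SmoothFn (JModel n) (JetBundle π)) 2⁻¹ * h1
      - extDWrt (horProj π S) θ X Y * algebraMap_half_mul_two (E := JModel n) (N := JetBundle π)
  tfae_finish
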